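/- Let $d,n\in\mathbb N$, let $a\in\mathbb R^n$ have nonzero entries and let $b\in\mathbb R^d$. For $X=[x_1,\dots,x_n]\in\mathbb R^{d\times n}$ let $F(X,t)=\sum_{i=1}^n\big(\tilde f_i(x_i)+\hat f_i(t)\big)$ and $\tilde F(X)=\sum_{i=1}^n\tilde f_i(x_i)$, where each $\tilde f_i:\mathbb R^d\to\mathbb R$ is strictly convex and differentiable and $\hat f_i:[0,\infty)\to\mathbb R$ is arbitrary. Let $S_b=\{X: Xa=b\}$ be the feasible set, and assume that for every $\gamma\in\mathbb R$ the set $\{X\in S_b:\tilde F(X)\le\gamma\}$ is bounded. Let $W(t)=[W_{ij}(t)]\in\mathbb R^{n\times n}$, $t\ge 0$, be symmetric link weights with $W_{ij}(t)\ge0$, each $W_{ij}$ integrable on bounded intervals. Assume that the network is uniformly connected: there are $c>0$ and a sequence of non-overlapping finite intervals $[t_k,t_k+l_k]\subset[0,\infty)$, $t_k+l_k\le t_{k+1}$, such that for every $k$ the graph on $\{1,\dots,n\}$ whose links are the pairs $i\ne j$ with $\int_{t_k}^{t_k+l_k}W_{ij}(s)\,ds\ge c$ contains a spanning tree. Let $g:\mathbb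 R^d\to\mathbb R^d$, possibly discontinuous, be locally bounded, odd and strongly sign-preserving: $g(-x)=-g(x)$, $g(0)=0$, and for every $x$ and every entry $p$, if $x_p>0$ then $g(x)_p>0$, if $x_p<0$ then $g(x)_p<0$, and if $x_p>0$ then there is $\kappa>0$ with $g(y)_p\ge \kappa$ for all $y$ in a neighborhood of $x$. Consider the nonlinear Laplacian-gradient dynamics $$\dot x_i=-\frac1{a_i}\sum_{j=1}^n W_{ij}(t)\,g\Big(\frac{\nabla\tilde f_i(x_i)}{a_i}-\frac{\nabla\tilde f_j(x_j)}{a_j}\Big),\qquad i=1,\dots,n,$$ understood as a differential inclusion in the sense of Filippov: with $h_t(X)\in\mathbb R^{d\times n}$ the right-hand side, a solution is a locally absolutely continuous $X:[0,\infty)\to\mathbb R^{d\times n}$ with $$\dot X(t)\in\bigcap_{\delta>0}\ \bigcap_{|N|=0}\overline{\mathrm{co}}\;h_t\big(B(X(t),\delta)\setminus N\big)\quad\text{for almost every } t\ge0,$$ where $|N|=0$ means that $N$ has Lebesgue measure zero. Then there is $X^*\in S_b$ which for every $t\ge0$ is the unique minimizer of $F(\cdot,t)$ over $S_b$, and: 1.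 for every $X_0\in S_b$ there is a solution on $[0,\infty)$ with $X(0)=X_0$; 2. every solution with $X(0)\in S_b$ satisfies $X(t)\in S_b$ for all $t\ge0$ and $X(t)\to X^*$ as $t\to\infty$; 3. $X^*$ is globally strongly asymptotically stable on $S_b$: all solutions starting in $S_b$ converge to $X^*$, and for every $\varepsilon>0$ there is $\delta>0$ such that every solution with $X(0)\in S_b$ and $\|X(0)-X^*\|<\delta$ satisfies $\|X(t)-X^*\|<\varepsilon$ for all $t\ge0$. -/

import Mathlib

open Set Filter Topology MeasureTheory

noncomputable section

/-! ### Differential inclusions -/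

/-- The Filippov regularization of a (possibly discontinuous) vector field `h`: the intersection,
over all radii `δ > 0` and all Lebesgue-null sets `N`, of the closed convex hulls of
`h (B(x, δ) \ N)`. -/
def filippov {E : Type*} [NormedAddCommGroup E] [NormedSpace ℝ E] [MeasureSpace E]
    (h : E → E) (x : E) : Set E :=
  ⋂ (δ : ℝ) (_ : 0 < δ) (N : Set E) (_ : volume N = 0),
    closure (convexHull ℝ (h '' (Metric.ball x δ \ N)))

/-- `X` is a solution on `[0, ∞)` of the differential inclusion `X'(t) ∈ F(t, X(t))`: it is
absolutely continuous on compact intervals and satisfies the inclusion for almost every `t ≥ 0`.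
The values of `X` at negative times are irrelevant. -/
def IsInclusionSolution {E : Type*} [NormedAddCommGroup E] [NormedSpace ℝ E]
    (F : ℝ → E → Set E) (X : ℝ → E) : Prop :=
  (∀ T : ℝ, 0 ≤ T → AbsolutelyContinuousOnInterval X 0 T) ∧
    ∀ᵐ t : ℝ, 0 ≤ t → ∃ v ∈ F t (X t), HasDerivAt X v t

/-- The point `x` of `S` is globally strongly asymptotically stable on `S` for the inclusion
`X'(t) ∈ F(t, X(t))`: it is Lyapunov stable and attractive along *all* solutions which start in
`S` at time `0`. -/
def IsGloballyStronglyAsymptoticallyStableOn {E : Type*} [NormedAddCommGroup E] [NormedSpace ℝ E]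
    (F : ℝ → E → Set E) (S : Set E) (x : E) : Prop :=
  x ∈ S ∧
  (∀ ε > 0, ∃ δ > 0, ∀ X : ℝ → E, IsInclusionSolution F X → X 0 ∈ S → dist (X 0) x < δ →
    ∀ t : ℝ, 0 ≤ t → dist (X t) x < ε) ∧
  (∀ X : ℝ → E, IsInclusionSolution F X → X 0 ∈ S → Tendsto X atTop (𝓝 x))

/-! ### The resource allocation problem -/

/-- The overall state `X = [x₁, …, xₙ]`, a `d × n` real matrix given by its columns `xᵢ ∈ ℝᵈ`. -/
abbrev AllocState (d n : ℕ) : Type := Fin n → EuclideanSpace ℝ (Fin d)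

/-- The feasible set `S_b = {X | X a = b}`. -/
def feasibleSet {d n : ℕ} (a : Fin n → ℝ) (b : EuclideanSpace ℝ (Fin d)) :
    Set (AllocState d n) :=
  {X | ∑ i, a i • X i = b}

/-- The time-invariant part `∑ᵢ fᵢ(xᵢ)` of the total cost. -/
def staticCost {d n : ℕ} (f : Fin n → EuclideanSpace ℝ (Fin d) → ℝ) (X : AllocState d n) : ℝ :=
  ∑ i, f i (X i)

/-- The total cost `F(X, t) = ∑ᵢ (fᵢ(xᵢ) + f̂ᵢ(t))`. -/
def totalCost {d n : ℕ} (f : Fin n → EuclideanSpace ℝ (Fin d) → ℝ) (fhat : Fin n → ℝ → ℝ)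
    (X : AllocState d n) (t : ℝ) : ℝ :=
  ∑ i, (f i (X i) + fhat i t)

/-- `X` solves the resource allocation problem at time `t`: it is feasible and minimizes
`F(·, t)` over the feasible set. -/
def IsOptimalAllocation {d n : ℕ} (f : Fin n → EuclideanSpace ℝ (Fin d) → ℝ)
    (fhat : Fin n → ℝ → ℝ) (a : Fin n → ℝ) (b : EuclideanSpace ℝ (Fin d)) (t : ℝ)
    (X : AllocState d n) : Prop :=
  X ∈ feasibleSet a b ∧ IsMinOn (fun Y => totalCost f fhat Y t) (feasibleSet a b) X

/-! ### The network -/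

/-- The union over the time interval `[s₀, s₁]` of the networks with link weights `W(t)`: the
distinct agents `i`, `j` are linked if the weight of the link accumulated during the interval is
at least `c`. -/
def unionGraph {n : ℕ} (W : ℝ → Matrix (Fin n) (Fin n) ℝ) (c s₀ s₁ : ℝ) : SimpleGraph (Fin n) :=
  SimpleGraph.fromRel fun i j => c ≤ ∫ s in s₀..s₁, W s i j

/-- Uniform connectivity: there is a sequence of non-overlapping finite intervals
`[t k, t k + l k]` such that the union network over each of them includes a spanning tree, with a
threshold `c > 0` for the accumulated weights which does not depend on the interval. -/
def IsUniformlyConnected {n : ℕ} (W : ℝ → Matrix (Fin n) (Fin n) ℝ) : Prop :=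
  ∃ c > 0, ∃ t l : ℕ → ℝ,
    (∀ k, 0 ≤ t k ∧ 0 ≤ l k ∧ t k + l k ≤ t (k + 1)) ∧
    ∀ k, ∃ T ≤ unionGraph W c (t k) (t k + l k), T.IsTree

/-- The assumptions on the time-varying undirected weighted network; agents `i ≠ j` are neighbors
at time `t` if `W t i j > 0`. -/
structure IsUniformlyConnectedNetwork {n : ℕ} (W : ℝ → Matrix (Fin n) (Fin n) ℝ) : Prop where
  symm : ∀ t, 0 ≤ t → (W t).IsSymm
  nonneg : ∀ t, 0 ≤ t → ∀ i j, 0 ≤ W t i j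
  integrable : ∀ i j, ∀ T : ℝ, IntegrableOn (fun t => W t i j) (Icc 0 T)
  connected : IsUniformlyConnected W

/-! ### The nonlinearity and the dynamics -/

/-- Odd, strongly sign-preserving nonlinearities, possibly discontinuous. Signs are entrywise; a
positive entry of the argument gives a positive entry of the value, and the latter stays away from
zero under small perturbations of the argument (so that the Filippov regularization still
preserves signs). -/
structure IsStronglySignPreserving {d : ℕ}
    (g : EuclideanSpace ℝ (Fin d) → EuclideanSpace ℝ (Fin d)) : Prop where
  odd : ∀ x, g (-x) = -g x
  map_zero : g 0 = 0
  pos : ∀ x p, 0 < x p → 0 < g x p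
  neg : ∀ x p, x p < 0 → g x p < 0
  locally_bounded : ∀ x, ∃ M : ℝ, ∀ᶠ y in 𝓝 x, ‖g y‖ ≤ M
  locally_away : ∀ x p, 0 < x p → ∃ c > 0, ∀ᶠ y in 𝓝 x, c ≤ g y p

/-- The nonlinear Laplacian-gradient vector field. The sum over all `j` is the sum over the
neighbors of `i`, as the other weights are zero and `g 0 = 0`. -/
def laplacianGradientField {d n : ℕ} (f : Fin n → EuclideanSpace ℝ (Fin d) → ℝ) (a : Fin n → ℝ)
    (W : ℝ → Matrix (Fin n) (Fin n) ℝ) (g : EuclideanSpace ℝ (Fin d) → EuclideanSpace ℝ (Fin d))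
    (t : ℝ) (X : AllocState d n) : AllocState d n :=
  fun i => -(a i)⁻¹ • ∑ j, W t i j •
    g ((a i)⁻¹ • gradient (f i) (X i) - (a j)⁻¹ • gradient (f j) (X j))

/-- The right-hand side of the differential inclusion: the Filippov regularization, in the state
variable, of the Laplacian-gradient vector field. -/
def laplacianGradientInclusion {d n : ℕ} (f : Fin n → EuclideanSpace ℝ (Fin d) → ℝ)
    (a : Fin n → ℝ) (W : ℝ → Matrix (Fin n) (Fin n) ℝ)
    (g : EuclideanSpace ℝ (Fin d) → EuclideanSpace ℝ (Fin d)) (t : ℝ) (X : AllocState d n) :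
    Set (AllocState d n) :=
  filippov (laplacianGradientField f a W g t) X

end

/-!
The right-hand side is linear in the link responses `g (zᵢ - zⱼ)`, where `zᵢ = ∇fᵢ(xᵢ) / aᵢ` are the
scaled marginal costs, and time enters through the weights only. For locally bounded maps the
Filippov regularization commutes with linear maps (`essHull_clm_comp`), so that the inclusion reads
`X' ∈ netFlow a (W t) '' K X` with a set-valued map `K` which is independent of time, convex and
compact valued and upper semicontinuous (`laplacianGradientInclusion_eq`). The elements of `K X` are
antisymmetric arrays whose entries have the signs of the entries of `zᵢ - zⱼ`, because the gradients
of differentiable convex functions are continuous (`ConvexOn.continuous_gradient`). Antisymmetry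
preserves feasibility, and the signs make the total cost a Lyapunov function: its derivative is
`-½ ∑ Wᵢⱼ ⟨zᵢ - zⱼ, ηᵢⱼ⟩` (`sum_inner_netFlow`, `staticCost_add_integral_le`).

The difficulty is that a trajectory may move while the cost hardly decreases: links in consensus do
not dissipate but may be active, with weights and switching rates which are not bounded on the
intervals of connectivity. Strict convexity excludes this. If the links in a set `J` are all near
consensus at a state, then this state nearly minimizes the cost among the states which are
accessible through `J`, and the cost does not increase; so the trajectory cannot get far away
through `J` (`exists_dist_le_of_near_consensus`). An induction on `J` turns this into a bound on
the displacement by the decrease of the cost alone (`exists_dist_le_of_staticCost_sub_le`). Since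
the cost converges, every trajectory is a Cauchy net and converges. By connectivity, marginal costs
which differ in the limit would cost a fixed amount on each of the intervals of connectivity
(`exists_tendsto_consensus`), so that the limit is in consensus, which characterizes the minimizer
(`staticCost_lt_of_consensus`).

Solutions exist by a Carathéodory-type theorem for inclusions `X' ∈ A(t) K(X)` with bounded `K` and
locally integrable `A` (`exists_isInclusionSolution`): Euler polygons have a common modulus of
continuity, hence a pointwise limit along an ultrafilter, and the inclusion is verified at Lebesgue
points of `A` by separating hyperplanes. The link responses are cut off outside a large ball to make
them bounded; the solution does not notice, as it stays in a bounded sublevel set of the cost.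
-/

/-! ### Absolutely continuous functions -/

/-- A function whose increments are dominated by those of an absolutely continuous function is
absolutely continuous. -/
lemma AbsolutelyContinuousOnInterval.of_dist_le {α β : Type*} [PseudoMetricSpace α]
    [PseudoMetricSpace β] {φ : ℝ → α} {ω : ℝ → β} {s t K : ℝ}
    (hω : AbsolutelyContinuousOnInterval ω s t)
    (h : ∀ x ∈ uIcc s t, ∀ y ∈ uIcc s t, dist (φ x) (φ y) ≤ K * dist (ω x) (ω y)) :
    AbsolutelyContinuousOnInterval φ s t := by
  unfold AbsolutelyContinuousOnInterval at hω ⊢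
  have h0 := hω.const_mul K
  rw [mul_zero] at h0
  refine tendsto_of_tendsto_of_tendsto_of_le_of_le' tendsto_const_nhds h0
    (Eventually.of_forall fun I => Finset.sum_nonneg fun _ _ => dist_nonneg) ?_
  have hmem : ∀ᶠ I in AbsolutelyContinuousOnInterval.totalLengthFilter ⊓
      𝓟 (AbsolutelyContinuousOnInterval.disjWithin s t),
      I ∈ AbsolutelyContinuousOnInterval.disjWithin s t :=
    mem_inf_of_right (mem_principal_self _)
  filter_upwards [hmem] with I hI
  rw [Finset.mul_sum]
  exact Finset.sum_le_sum fun i hi => h _ (hI.1 i hi).1 _ (hI.1 i hi).2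

/-- Composing with a locally Lipschitz function preserves absolute continuity, since the path has
compact range. -/
lemma LocallyLipschitz.comp_absolutelyContinuousOnInterval {α β : Type*} [SeminormedAddCommGroup α]
    [PseudoMetricSpace β] {F : α → β} (hF : LocallyLipschitz F) {X : ℝ → α} {s t : ℝ}
    (hX : AbsolutelyContinuousOnInterval X s t) :
    AbsolutelyContinuousOnInterval (fun r => F (X r)) s t := by
  have hc : IsCompact (X '' uIcc s t) := isCompact_uIcc.image_of_continuousOn hX.continuousOn
  have hl : LocallyLipschitzOn (X '' uIcc s t) F := hF.locallyLipschitzOn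
  obtain ⟨K, hK⟩ := hl.exists_lipschitzOnWith_of_compact hc
  refine AbsolutelyContinuousOnInterval.of_dist_le (K := K) hX fun x hx y hy => ?_
  exact hK.dist_le_mul _ (mem_image_of_mem X hx) _ (mem_image_of_mem X hy)

/-- An absolutely continuous function grows at most by the integral of an almost everywhere upper
bound of its derivative. -/
lemma AbsolutelyContinuousOnInterval.sub_le_integral {φ B : ℝ → ℝ} {s t : ℝ} (hst : s ≤ t)
    (hφ : AbsolutelyContinuousOnInterval φ s t) (hB : IntervalIntegrable B volume s t)
    (h : ∀ᵐ r : ℝ, r ∈ Icc s t → ∃ v, HasDerivAt φ v r ∧ v ≤ B r) :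
    φ t - φ s ≤ ∫ r in s..t, B r := by
  rw [← hφ.integral_deriv_eq_sub]
  refine intervalIntegral.integral_mono_ae_restrict hst hφ.intervalIntegrable_deriv hB ?_
  refine (ae_restrict_iff' measurableSet_Icc).2 ?_
  filter_upwards [h] with r hr hrm
  obtain ⟨v, hv, hvB⟩ := hr hrm
  rwa [hv.deriv]

/-! ### Differentiable convex functions -/

section Convex

variable {E : Type*} [NormedAddCommGroup E] [InnerProductSpace ℝ E] [CompleteSpace E]

/-- A differentiable convex function lies above its tangent hyperplanes. -/
lemma ConvexOn.add_inner_gradient_le {f : E → ℝ} (hf : ConvexOn ℝ univ f) {x : E}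
    (hd : DifferentiableAt ℝ f x) (y : E) :
    f x + inner ℝ (gradient f x) (y - x) ≤ f y := by
  have hc : ConvexOn ℝ univ (fun τ : ℝ => f (AffineMap.lineMap x y τ)) := by
    exact hf.comp_affineMap (AffineMap.lineMap (k := ℝ) x y)
  have hl : HasDerivAt (fun τ : ℝ => AffineMap.lineMap x y τ) (y - x) 0 :=
    AffineMap.hasDerivAt_lineMap
  have hg : HasFDerivAt f (InnerProductSpace.toDual ℝ E (gradient f x))
      (AffineMap.lineMap x y (0 : ℝ)) := by
    simpa using hd.hasGradientAt.hasFDerivAt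
  have hdv := hg.comp_hasDerivAt (0 : ℝ) hl
  have h := hc.le_slope_of_hasDerivAt (mem_univ (0 : ℝ)) (mem_univ (1 : ℝ)) one_pos hdv
  rw [slope_def_field] at h
  simp only [InnerProductSpace.toDual_apply_apply, AffineMap.lineMap_apply_one,
    AffineMap.lineMap_apply_zero, sub_zero, div_one] at h
  linarith

lemma StrictConvexOn.add_inner_gradient_lt {f : E → ℝ} (hf : StrictConvexOn ℝ univ f) {x y : E}
    (hd : DifferentiableAt ℝ f x) (hxy : x ≠ y) :
    f x + inner ℝ (gradient f x) (y - x) < f y := by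
  -- The tangent inequality at the midpoint, together with strict convexity there.
  have h1 := hf.convexOn.add_inner_gradient_le hd ((1 / 2 : ℝ) • x + (1 / 2 : ℝ) • y)
  have h2 := hf.2 (mem_univ x) (mem_univ y) hxy (by norm_num : (0 : ℝ) < 1 / 2)
    (by norm_num : (0 : ℝ) < 1 / 2) (by norm_num)
  have h3 : (1 / 2 : ℝ) • x + (1 / 2 : ℝ) • y - x = (1 / 2 : ℝ) • (y - x) := by
    module
  rw [h3, inner_smul_right] at h1
  simp only [smul_eq_mul] at h2
  linarith

/-- A subgradient of a function at a point of differentiability is the gradient. -/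
lemma gradient_eq_of_forall_add_inner_le {f : E → ℝ} {x p : E} (hd : DifferentiableAt ℝ f x)
    (h : ∀ y, f x + inner ℝ p (y - x) ≤ f y) : gradient f x = p := by
  have hmin : IsLocalMin (fun y => f y - InnerProductSpace.toDual ℝ E p y) x := by
    refine Eventually.of_forall fun y => ?_
    have := h y
    simp only [InnerProductSpace.toDual_apply_apply, inner_sub_right] at this ⊢
    linarith
  have hz := hmin.hasFDerivAt_eq_zero
    (hd.hasGradientAt.hasFDerivAt.sub (InnerProductSpace.toDual ℝ E p).hasFDerivAt)
  rw [sub_eq_zero] at hz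
  exact (InnerProductSpace.toDual ℝ E).injective hz

/-- A differentiable convex function on a finite-dimensional space is continuously differentiable:
the gradients are locally bounded, and their cluster points at `x` are subgradients at `x`. -/
lemma ConvexOn.continuous_gradient [FiniteDimensional ℝ E] {f : E → ℝ} (hf : ConvexOn ℝ univ f)
    (hd : Differentiable ℝ f) : Continuous (gradient f) := by
  rw [continuous_iff_continuousAt]
  intro x
  obtain ⟨K, U, hU, hK⟩ := hf.locallyLipschitz x
  have hbd : ∀ᶠ y in 𝓝 x, gradient f y ∈ Metric.closedBall (0 : E) K := by
    filter_upwards [eventually_eventually_nhds.2 hU] with y hy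
    rw [mem_closedBall_zero_iff, gradient, LinearIsometryEquiv.norm_map]
    exact norm_fderiv_le_of_lipschitzOn ℝ hy hK
  refine tendsto_iff_ultrafilter _ _ _ |>.2 fun 𝒰 h𝒰 => ?_
  obtain ⟨p, -, hp⟩ := (isCompact_closedBall (0 : E) (K : ℝ)).ultrafilter_le_nhds
    (𝒰.map (gradient f)) (le_principal_iff.2 (h𝒰 hbd))
  have hp' : Tendsto (gradient f) 𝒰 (𝓝 p) := hp
  suffices gradient f x = p by rwa [this]
  refine gradient_eq_of_forall_add_inner_le (hd x) fun y => ?_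
  have hx : Tendsto (fun z => z) (𝒰 : Filter E) (𝓝 x) := h𝒰
  have hfx : Tendsto f (𝒰 : Filter E) (𝓝 (f x)) := (hd.continuous.tendsto x).mono_left h𝒰
  exact le_of_tendsto (hfx.add (hp'.inner (tendsto_const_nhds.sub hx)))
    (Eventually.of_forall fun z => hf.add_inner_gradient_le (hd z) y)

end Convex

/-! ### Essential convex hulls -/

section EssHull

variable {E F H : Type*} [NormedAddCommGroup E] [MeasureSpace E] [NormedAddCommGroup F]
  [NormedSpace ℝ F] [NormedAddCommGroup H] [NormedSpace ℝ H]

/-- The essential closed convex hull of the values of `G` near `x`. This is the Filippov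
regularization for a map `G` whose values lie in another space than its arguments. -/
def essHull (G : E → F) (x : E) : Set F :=
  ⋂ (δ : ℝ) (_ : 0 < δ) (N : Set E) (_ : volume N = 0),
    closure (convexHull ℝ (G '' (Metric.ball x δ \ N)))

lemma mem_essHull {G : E → F} {x : E} {η : F} :
    η ∈ essHull G x ↔ ∀ δ : ℝ, 0 < δ → ∀ N : Set E, volume N = 0 →
      η ∈ closure (convexHull ℝ (G '' (Metric.ball x δ \ N))) := by
  simp [essHull]

lemma isClosed_essHull (G : E → F) (x : E) : IsClosed (essHull G x) :=
  isClosed_iInter fun _ => isClosed_iInter fun _ => isClosed_iInter fun _ =>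
    isClosed_iInter fun _ => isClosed_closure

lemma convex_essHull (G : E → F) (x : E) : Convex ℝ (essHull G x) :=
  convex_iInter fun _ => convex_iInter fun _ => convex_iInter fun _ =>
    convex_iInter fun _ => (convex_convexHull ℝ _).closure

/-- Closed convex constraints on the values of `G` near `x` pass to the essential hull at `x`. -/
lemma essHull_subset_of_eventually {G : E → F} {x : E} {C : Set F} (hC : IsClosed C)
    (hconv : Convex ℝ C) (h : ∀ᶠ y in 𝓝 x, G y ∈ C) : essHull G x ⊆ C := by
  obtain ⟨δ, hδ, hball⟩ := Metric.eventually_nhds_iff_ball.1 h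
  intro η hη
  refine closure_minimal (convexHull_min ?_ hconv) hC
    (mem_essHull.1 hη δ hδ ∅ (by simp))
  rintro _ ⟨y, hy, rfl⟩
  exact hball y hy.1

/-- The essential hull at `x` depends only on the germ of `G` at `x`. -/
lemma essHull_subset_of_eventuallyEq {G G' : E → F} {x : E} (h : G =ᶠ[𝓝 x] G') :
    essHull G x ⊆ essHull G' x := by
  obtain ⟨ε, hε, hball⟩ := Metric.eventually_nhds_iff_ball.1 h
  intro η hη
  refine mem_essHull.2 fun δ hδ N hN => ?_
  refine closure_mono (convexHull_mono ?_) (mem_essHull.1 hη (min ε δ) (lt_min hε hδ) N hN)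
  rintro _ ⟨y, hy, rfl⟩
  exact ⟨y, ⟨Metric.ball_subset_ball (min_le_right _ _) hy.1, hy.2⟩,
    (hball y (Metric.ball_subset_ball (min_le_left _ _) hy.1)).symm⟩

lemma image_essHull_subset (L : F →L[ℝ] H) (G : E → F) (x : E) :
    L '' essHull G x ⊆ essHull (fun y => L (G y)) x := by
  rintro _ ⟨η, hη, rfl⟩
  refine mem_essHull.2 fun δ hδ N hN => ?_
  have h := image_closure_subset_closure_image L.continuous
    (mem_image_of_mem L (mem_essHull.1 hη δ hδ N hN))
  have himg : (L : F → H) '' convexHull ℝ (G '' (Metric.ball x δ \ N)) =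
      convexHull ℝ ((fun y => L (G y)) '' (Metric.ball x δ \ N)) := by
    rw [show (fun y => L (G y)) '' (Metric.ball x δ \ N) =
      (L : F →ₗ[ℝ] H) '' (G '' (Metric.ball x δ \ N)) from (image_image _ _ _).symm]
    exact (L : F →ₗ[ℝ] H).image_convexHull _
  rwa [himg] at h

variable [FiniteDimensional ℝ F]

/-- For a locally bounded `G`, a closed set which meets each of the closed convex hulls defining
the essential hull meets the essential hull itself: by compactness, since those hulls form a
directed family. -/
lemma essHull_inter_nonempty {G : E → F} {x : E} {M : ℝ} (hM : ∀ᶠ y in 𝓝 x, ‖G y‖ ≤ M)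
    {S : Set F} (hS : IsClosed S)
    (h : ∀ δ : ℝ, 0 < δ → ∀ N : Set E, volume N = 0 →
      (closure (convexHull ℝ (G '' (Metric.ball x δ \ N))) ∩ S).Nonempty) :
    (essHull G x ∩ S).Nonempty := by
  obtain ⟨δ₀, hδ₀, hball⟩ := Metric.eventually_nhds_iff_ball.1 hM
  let ι := {p : ℝ × Set E // (0 < p.1 ∧ p.1 ≤ δ₀) ∧ volume p.2 = 0}
  let A : ι → Set F := fun p =>
    closure (convexHull ℝ (G '' (Metric.ball x p.1.1 \ p.1.2))) ∩ S
  have : Nonempty ι := ⟨⟨(δ₀, ∅), ⟨hδ₀, le_rfl⟩, by simp⟩⟩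
  have hcl : ∀ p, IsClosed (A p) := fun p => isClosed_closure.inter hS
  have hcpt : ∀ p, IsCompact (A p) := by
    intro p
    refine (isCompact_closedBall (0 : F) M).of_isClosed_subset (hcl p) ?_
    refine inter_subset_left.trans (closure_minimal (convexHull_min ?_ (convex_closedBall _ _))
      Metric.isClosed_closedBall)
    rintro _ ⟨y, hy, rfl⟩
    exact mem_closedBall_zero_iff.2 (hball y (Metric.ball_subset_ball p.2.1.2 hy.1))
  have hdir : Directed (· ⊇ ·) A := by
    intro p q
    refine ⟨⟨(min p.1.1 q.1.1, p.1.2 ∪ q.1.2),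
      ⟨lt_min p.2.1.1 q.2.1.1, (min_le_left _ _).trans p.2.1.2⟩,
      measure_union_null p.2.2 q.2.2⟩, ?_, ?_⟩
    · exact inter_subset_inter_left _ (closure_mono (convexHull_mono (image_mono
        (sdiff_subset_sdiff (Metric.ball_subset_ball (min_le_left _ _)) subset_union_left))))
    · exact inter_subset_inter_left _ (closure_mono (convexHull_mono (image_mono
        (sdiff_subset_sdiff (Metric.ball_subset_ball (min_le_right _ _)) subset_union_right))))
  obtain ⟨η, hη⟩ := IsCompact.nonempty_iInter_of_directed_nonempty_isCompact_isClosed A hdir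
    (fun p => h p.1.1 p.2.1.1 p.1.2 p.2.2) hcpt hcl
  have hmem := mem_iInter.1 hη
  refine ⟨η, mem_essHull.2 fun δ hδ N hN => ?_, (hmem (Classical.arbitrary ι)).2⟩
  refine closure_mono (convexHull_mono (image_mono (sdiff_subset_sdiff_left
    (Metric.ball_subset_ball (min_le_left δ δ₀)))))
    (hmem ⟨(min δ δ₀, N), ⟨lt_min hδ hδ₀, min_le_right _ _⟩, hN⟩).1

lemma essHull_nonempty [(volume : Measure E).IsOpenPosMeasure] {G : E → F} {x : E} {M : ℝ}
    (hM : ∀ᶠ y in 𝓝 x, ‖G y‖ ≤ M) : (essHull G x).Nonempty := by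
  refine (essHull_inter_nonempty hM isClosed_univ fun δ hδ N hN => ?_).mono inter_subset_left
  rw [inter_univ, closure_nonempty_iff, convexHull_nonempty_iff, image_nonempty]
  refine nonempty_of_measure_ne_zero (μ := volume) ?_
  rw [measure_sdiff_null hN]
  exact (Metric.measure_ball_pos volume x hδ).ne'

/-- The essential hull commutes with continuous linear maps, for locally bounded maps. -/
lemma essHull_clm_comp (L : F →L[ℝ] H) {G : E → F} {x : E} {M : ℝ}
    (hM : ∀ᶠ y in 𝓝 x, ‖G y‖ ≤ M) :
    essHull (fun y => L (G y)) x = L '' essHull G x := by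
  refine Subset.antisymm (fun v hv => ?_) (image_essHull_subset L G x)
  obtain ⟨δ₀, hδ₀, hball⟩ := Metric.eventually_nhds_iff_ball.1 hM
  obtain ⟨η, hη, hηv⟩ := essHull_inter_nonempty (S := L ⁻¹' {v}) hM
    (isClosed_singleton.preimage L.continuous) fun δ hδ N hN => by
      set B := convexHull ℝ (G '' (Metric.ball x (min δ δ₀) \ N)) with hB
      have hBc : IsCompact (closure B) := by
        refine (isCompact_closedBall (0 : F) M).of_isClosed_subset isClosed_closure
          (closure_minimal (convexHull_min ?_ (convex_closedBall _ _))
            Metric.isClosed_closedBall)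
        rintro _ ⟨y, hy, rfl⟩
        exact mem_closedBall_zero_iff.2
          (hball y (Metric.ball_subset_ball (min_le_right _ _) hy.1))
      have hsub : closure (convexHull ℝ
          ((fun y => L (G y)) '' (Metric.ball x (min δ δ₀) \ N))) ⊆ L '' closure B := by
        refine closure_minimal (convexHull_min ?_ ?_) (hBc.image L.continuous).isClosed
        · rintro _ ⟨y, hy, rfl⟩
          exact mem_image_of_mem L (subset_closure (subset_convexHull ℝ _ (mem_image_of_mem G hy)))
        · exact (convex_convexHull ℝ _).closure.linear_image (L : F →ₗ[ℝ] H)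
      obtain ⟨η, hη, hηv⟩ := hsub (mem_essHull.1 hv _ (lt_min hδ hδ₀) N hN)
      exact ⟨η, closure_mono (convexHull_mono (image_mono (sdiff_subset_sdiff_left
        (Metric.ball_subset_ball (min_le_left δ δ₀))))) hη, hηv⟩
  exact ⟨η, hη, hηv⟩

/-- Upper semicontinuity of the essential hull. -/
lemma eventually_essHull_subset {G : E → F} {x : E} {M : ℝ} (hM : ∀ᶠ y in 𝓝 x, ‖G y‖ ≤ M)
    {U : Set F} (hU : IsOpen U) (h : essHull G x ⊆ U) : ∀ᶠ y in 𝓝 x, essHull G y ⊆ U := by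
  obtain ⟨δ, hδ, N, hN, hsub⟩ : ∃ δ : ℝ, 0 < δ ∧ ∃ N : Set E, volume N = 0 ∧
      closure (convexHull ℝ (G '' (Metric.ball x δ \ N))) ⊆ U := by
    by_contra! hne
    obtain ⟨η, hη, hηU⟩ := essHull_inter_nonempty hM hU.isClosed_compl fun δ hδ N hN =>
      inter_compl_nonempty_iff.2 (hne δ hδ N hN)
    exact hηU (h hη)
  filter_upwards [Metric.ball_mem_nhds x (half_pos hδ)] with y hy
  refine Subset.trans (fun η hη => ?_) hsub
  refine closure_mono (convexHull_mono (image_mono (sdiff_subset_sdiff_left ?_)))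
    (mem_essHull.1 hη (δ / 2) (half_pos hδ) N hN)
  exact Metric.ball_subset_ball' (by linarith [Metric.mem_ball.1 hy])

end EssHull

/-! ### Existence of solutions -/

section Existence

variable {E F : Type*} [NormedAddCommGroup E] [NormedSpace ℝ E] [NormedAddCommGroup F]
  [NormedSpace ℝ F]

lemma MeasureTheory.LocallyIntegrable.intervalIntegrable_of_real {V : Type*} [NormedAddCommGroup V]
    {A : ℝ → V} (hA : LocallyIntegrable A) (s t : ℝ) : IntervalIntegrable A volume s t :=
  (hA.integrableOn_isCompact isCompact_uIcc).intervalIntegrable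

lemma intervalIntegrable_clm_apply {A : ℝ → F →L[ℝ] E} (hA : LocallyIntegrable A) {c : ℝ → F}
    (hc : StronglyMeasurable c) {M : ℝ} (hM : ∀ s, ‖c s‖ ≤ M) (s t : ℝ) :
    IntervalIntegrable (fun r => A r (c r)) volume s t := by
  have hAi : IntervalIntegrable A volume s t := hA.intervalIntegrable_of_real s t
  refine (hAi.norm.mul_const M).mono_fun ?_ ?_
  · exact isBoundedBilinearMap_apply.continuous.comp_aestronglyMeasurable
      (hAi.def'.aestronglyMeasurable.prodMk hc.aestronglyMeasurable)
  · refine Eventually.of_forall fun r => ?_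
    simp only
    rw [Real.norm_of_nonneg (mul_nonneg (norm_nonneg (A r)) ((norm_nonneg _).trans (hM r)))]
    exact (A r).le_opNorm_of_le (hM r)

/-- Increments of a trajectory driven by a control `c` bounded by `M` are at most `M` times the
integral of `‖A‖`. -/
lemma dist_integral_clm_apply_le {A : ℝ → F →L[ℝ] E} (hA : LocallyIntegrable A) {c : ℝ → F}
    (hc : StronglyMeasurable c) {M : ℝ} (hM : ∀ s, ‖c s‖ ≤ M) (x₀ : E) (s t : ℝ) :
    dist (x₀ + ∫ r in (0 : ℝ)..t, A r (c r)) (x₀ + ∫ r in (0 : ℝ)..s, A r (c r)) ≤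
      M * dist (∫ r in (0 : ℝ)..t, ‖A r‖) (∫ r in (0 : ℝ)..s, ‖A r‖) := by
  have hi := intervalIntegrable_clm_apply hA hc hM
  have hn : ∀ s t, IntervalIntegrable (fun r => ‖A r‖) volume s t :=
    fun s t => (hA.intervalIntegrable_of_real s t).norm
  rw [dist_add_left, dist_eq_norm, Real.dist_eq,
    intervalIntegral.integral_interval_sub_left (hi 0 t) (hi 0 s),
    intervalIntegral.integral_interval_sub_left (hn 0 t) (hn 0 s)]
  have hM0 : 0 ≤ M := (norm_nonneg _).trans (hM 0)
  rw [← abs_of_nonneg hM0, ← abs_mul, ← intervalIntegral.integral_const_mul]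
  refine intervalIntegral.norm_integral_le_abs_of_norm_le (Eventually.of_forall fun r => ?_)
    ((hn s t).const_mul M)
  rw [mul_comm]
  exact (A r).le_opNorm_of_le (hM r)

/-- Euler polygons with step `h`: the control on each step is a value of `K` at the point where
the step begins. -/
lemma exists_euler_polygon {A : ℝ → F →L[ℝ] E} (hA : LocallyIntegrable A) {K : E → Set F} {M : ℝ}
    (hM : ∀ x, ∀ η ∈ K x, ‖η‖ ≤ M) (hne : ∀ x, (K x).Nonempty) (x₀ : E) {h : ℝ} (hh : 0 < h) :
    ∃ c : ℝ → F, StronglyMeasurable c ∧ (∀ s, ‖c s‖ ≤ M) ∧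
      ∀ s, 0 ≤ s → ∃ r, 0 ≤ r ∧ r ≤ s ∧ s ≤ r + h ∧
        c s ∈ K (x₀ + ∫ q in (0 : ℝ)..r, A q (c q)) := by
  choose σ hσ using hne
  let y : ℕ → E := fun k => Nat.rec x₀
    (fun k x => x + ∫ q in (k * h : ℝ)..((k + 1 : ℕ) * h : ℝ), A q (σ x)) k
  let c : ℝ → F := fun s => σ (y ⌊s / h⌋₊)
  have hcm : StronglyMeasurable c :=
    (StronglyMeasurable.of_discrete (f := fun k : ℕ => σ (y k))).comp_measurable
      (Nat.measurable_floor.comp (measurable_id.div_const h))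
  have hcM : ∀ s, ‖c s‖ ≤ M := fun s => hM _ _ (hσ _)
  have hi := intervalIntegrable_clm_apply hA hcm hcM
  have hstep : ∀ k : ℕ, ∫ q in (k * h : ℝ)..((k + 1 : ℕ) * h : ℝ), A q (c q) =
      ∫ q in (k * h : ℝ)..((k + 1 : ℕ) * h : ℝ), A q (σ (y k)) := by
    intro k
    have hle : (k * h : ℝ) ≤ ((k + 1 : ℕ) * h : ℝ) := by push_cast; nlinarith
    rw [intervalIntegral.integral_of_le hle, intervalIntegral.integral_of_le hle,
      ← integral_Ico_eq_integral_Ioc, ← integral_Ico_eq_integral_Ioc]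
    refine setIntegral_congr_fun measurableSet_Ico fun q hq => ?_
    have hfl : ⌊q / h⌋₊ = k := by
      rw [Nat.floor_eq_iff (div_nonneg ((by positivity : (0 : ℝ) ≤ k * h).trans hq.1) hh.le),
        le_div_iff₀ hh, div_lt_iff₀ hh]
      exact ⟨hq.1, by simpa using hq.2⟩
    simp only [c, hfl]
  have hgrid : ∀ k : ℕ, x₀ + ∫ q in (0 : ℝ)..(k * h : ℝ), A q (c q) = y k := by
    intro k
    induction k with
    | zero => simp [y]
    | succ k ih =>
      rw [← intervalIntegral.integral_add_adjacent_intervals (hi 0 (k * h)) (hi _ _),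
        ← add_assoc, ih, hstep]
  refine ⟨c, hcm, hcM, fun s hs => ⟨⌊s / h⌋₊ * h, by positivity, ?_, ?_, ?_⟩⟩
  · exact (le_div_iff₀ hh).1 (Nat.floor_le (div_nonneg hs hh.le))
  · have := (div_lt_iff₀ hh).1 (Nat.lt_floor_add_one (s / h))
    linarith
  · rw [hgrid]
    exact hσ _

/-- Almost every point is a right Lebesgue point of a locally integrable function. -/
lemma ae_tendsto_integral_norm_sub_div {V : Type*} [NormedAddCommGroup V] {A : ℝ → V}
    (hA : LocallyIntegrable A) :
    ∀ᵐ t : ℝ, Tendsto (fun b => (b - t)⁻¹ * ∫ s in t..b, ‖A s - A t‖) (𝓝[>] t) (𝓝 0) := by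
  filter_upwards [(IsUnifLocDoublingMeasure.vitaliFamily (volume : Measure ℝ)
    1).ae_tendsto_average_norm_sub hA] with t ht
  refine (ht.comp (Real.tendsto_Icc_vitaliFamily_right t)).congr' ?_
  filter_upwards [self_mem_nhdsWithin] with b hb
  have hb' : t < b := hb
  simp only [Function.comp_apply]
  rw [setAverage_eq, intervalIntegral.integral_of_le hb'.le, integral_Icc_eq_integral_Ioc]
  simp [measureReal_def, hb'.le]

variable [FiniteDimensional ℝ E] [FiniteDimensional ℝ F]

/-- If the speeds `A s (c s)` of approximate trajectories take their controls from convex compact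
sets upper semicontinuous in the state, then the derivative of a pointwise limit belongs to the
right-hand side, at every right Lebesgue point of `A`. A hyperplane separating the derivative from
the right-hand side would bound the increments of the approximations, hence of the limit. -/
lemma mem_image_of_tendsto_of_hasDerivAt {ι : Type*} {𝒰 : Filter ι} [𝒰.NeBot]
    {A : ℝ → F →L[ℝ] E} (hA : LocallyIntegrable A) {K : E → Set F} {M : ℝ}
    (hM : ∀ x, ∀ η ∈ K x, ‖η‖ ≤ M) (hconv : ∀ x, Convex ℝ (K x)) (hcl : ∀ x, IsClosed (K x))
    (husc : ∀ x, ∀ U : Set F, IsOpen U → K x ⊆ U → ∀ᶠ y in 𝓝 x, K y ⊆ U)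
    {x₀ : E} {c : ι → ℝ → F} (hcm : ∀ m, StronglyMeasurable (c m)) (hcM : ∀ m s, ‖c m s‖ ≤ M)
    {h : ι → ℝ} (hh : Tendsto h 𝒰 (𝓝 0))
    (hc : ∀ m s, 0 ≤ s → ∃ r, 0 ≤ r ∧ r ≤ s ∧ s ≤ r + h m ∧
      c m s ∈ K (x₀ + ∫ q in (0 : ℝ)..r, A q (c m q)))
    {X : ℝ → E} (hX : ∀ t, Tendsto (fun m => x₀ + ∫ q in (0 : ℝ)..t, A q (c m q)) 𝒰 (𝓝 (X t)))
    {t : ℝ} (ht : 0 ≤ t)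
    (hleb : Tendsto (fun b => (b - t)⁻¹ * ∫ s in t..b, ‖A s - A t‖) (𝓝[>] t) (𝓝 0))
    {v : E} (hv : HasDerivAt X v t) : v ∈ A t '' K (X t) := by
  by_contra hvn
  have hKc : IsCompact (K (X t)) := (isCompact_closedBall (0 : F) M).of_isClosed_subset (hcl _)
    fun η hη => mem_closedBall_zero_iff.2 (hM _ η hη)
  obtain ⟨ℓ, u, hlu, huv⟩ := geometric_hahn_banach_closed_point
    ((hconv (X t)).linear_image (A t : F →ₗ[ℝ] E)) (hKc.image (A t).continuous).isClosed hvn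
  have hU : ∀ᶠ y in 𝓝 (X t), K y ⊆ {η | ℓ (A t η) < u} :=
    husc _ _ (isOpen_lt (by fun_prop) continuous_const)
      fun η hη => hlu _ (mem_image_of_mem (A t) hη)
  obtain ⟨ε, hε, hball⟩ := Metric.eventually_nhds_iff_ball.1 hU
  have hM0 : 0 ≤ M := by
    have := 𝒰.nonempty_of_neBot
    obtain ⟨m⟩ := this
    exact (norm_nonneg _).trans (hcM m 0)
  -- The modulus of continuity common to all the approximations.
  have hω : Continuous fun b => M * dist (∫ r in (0 : ℝ)..b, ‖A r‖) (∫ r in (0 : ℝ)..t, ‖A r‖) :=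
    continuous_const.mul ((intervalIntegral.continuous_primitive
      (fun s t => (hA.intervalIntegrable_of_real s t).norm) 0).dist continuous_const)
  obtain ⟨δ, hδ, hδball⟩ := Metric.eventually_nhds_iff_ball.1
    ((hω.tendsto t).eventually_lt_const (u := ε / 2) (by simpa using half_pos hε))
  have hbound : ∀ b ∈ Ioo t (t + δ), ℓ (X b) - ℓ (X t) ≤
      u * (b - t) + ‖ℓ‖ * M * ∫ s in t..b, ‖A s - A t‖ := by
    intro b hb
    have hlim := ((ℓ.continuous.tendsto _).comp (hX b)).sub ((ℓ.continuous.tendsto _).comp (hX t))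
    refine le_of_tendsto hlim ?_
    filter_upwards [(hX t).eventually (Metric.ball_mem_nhds _ (half_pos hε)),
      hh.eventually (gt_mem_nhds hδ)] with m hm hhm
    have hi := intervalIntegrable_clm_apply hA (hcm m) (hcM m)
    have hd : IntervalIntegrable (fun s => ‖A s - A t‖) volume t b :=
      ((hA.intervalIntegrable_of_real t b).sub intervalIntegrable_const).norm
    simp only [Function.comp_apply]
    rw [← map_sub, add_sub_add_left_eq_sub,
      intervalIntegral.integral_interval_sub_left (hi 0 b) (hi 0 t),
      ← ContinuousLinearMap.intervalIntegral_comp_comm _ (hi t b)]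
    have hrhs : u * (b - t) + ‖ℓ‖ * M * ∫ s in t..b, ‖A s - A t‖ =
        ∫ s in t..b, (u + ‖ℓ‖ * M * ‖A s - A t‖) := by
      rw [intervalIntegral.integral_add intervalIntegrable_const (hd.const_mul _),
        intervalIntegral.integral_const, intervalIntegral.integral_const_mul, smul_eq_mul,
        mul_comm u]
    rw [hrhs]
    refine intervalIntegral.integral_mono_on hb.1.le
      ⟨ℓ.integrable_comp (hi t b).1, ℓ.integrable_comp (hi t b).2⟩ (intervalIntegrable_const.add (hd.const_mul _)) ?_
    intro s hs
    obtain ⟨r, hr0, hrs, hsr, hmem⟩ := hc m s (ht.trans hs.1)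
    have hrt : r ∈ Metric.ball t δ := by
      rw [Metric.mem_ball, Real.dist_eq, abs_lt]
      constructor <;> linarith [hs.1, hs.2, hb.2]
    have h1 : dist (x₀ + ∫ q in (0 : ℝ)..r, A q (c m q)) (X t) < ε := by
      have h2 := (dist_integral_clm_apply_le hA (hcm m) (hcM m) x₀ t r).trans_lt (hδball r hrt)
      have h3 := dist_triangle (x₀ + ∫ q in (0 : ℝ)..r, A q (c m q))
        (x₀ + ∫ q in (0 : ℝ)..t, A q (c m q)) (X t)
      have h4 : dist (x₀ + ∫ q in (0 : ℝ)..t, A q (c m q)) (X t) < ε / 2 := hm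
      linarith
    have h5 : ℓ (A t (c m s)) < u := hball _ h1 hmem
    have h6 : ℓ (A s (c m s)) = ℓ (A t (c m s)) + ℓ ((A s - A t) (c m s)) := by
      simp
    have h7 : ℓ ((A s - A t) (c m s)) ≤ ‖ℓ‖ * (‖A s - A t‖ * M) :=
      (le_abs_self _).trans (ℓ.le_opNorm_of_le ((A s - A t).le_opNorm_of_le (hcM m s)))
    rw [h6]
    linarith
  -- Dividing by `b - t` and letting `b` decrease to `t` contradicts the separation.
  have hslope : Tendsto (fun b => (b - t)⁻¹ * (ℓ (X b) - ℓ (X t))) (𝓝[>] t) (𝓝 (ℓ v)) := by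
    have h1 := (ℓ.hasFDerivAt.comp_hasDerivAt t hv).tendsto_slope.mono_left
      (nhdsWithin_mono t fun b (hb : t < b) => hb.ne')
    refine h1.congr fun b => ?_
    simp [slope_def_field, div_eq_inv_mul]
  have hrhs : Tendsto (fun b => u + ‖ℓ‖ * M * ((b - t)⁻¹ * ∫ s in t..b, ‖A s - A t‖))
      (𝓝[>] t) (𝓝 u) := by
    simpa using (hleb.const_mul (‖ℓ‖ * M)).const_add u
  refine absurd (le_of_tendsto_of_tendsto hslope hrhs ?_) (not_le.2 huv)
  filter_upwards [Ioo_mem_nhdsGT (by linarith : t < t + δ)] with b hb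
  have hbt : 0 < b - t := sub_pos.2 hb.1
  rw [inv_mul_le_iff₀ hbt]
  refine (hbound b hb).trans_eq ?_
  field_simp

/-- A bilinear differential inclusion `X' ∈ A(t) K(X)`, whose time dependence is merely locally
integrable, has a solution on `[0, ∞)` from every initial point, provided that `K` is bounded and
upper semicontinuous with nonempty closed convex values. A solution is a pointwise limit, along an
ultrafilter, of Euler polygons. -/
theorem exists_isInclusionSolution {A : ℝ → F →L[ℝ] E} (hA : LocallyIntegrable A)
    {K : E → Set F} {M : ℝ} (hM : ∀ x, ∀ η ∈ K x, ‖η‖ ≤ M) (hne : ∀ x, (K x).Nonempty)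
    (hconv : ∀ x, Convex ℝ (K x)) (hcl : ∀ x, IsClosed (K x))
    (husc : ∀ x, ∀ U : Set F, IsOpen U → K x ⊆ U → ∀ᶠ y in 𝓝 x, K y ⊆ U) (x₀ : E) :
    ∃ X : ℝ → E, IsInclusionSolution (fun t x => A t '' K x) X ∧ X 0 = x₀ := by
  choose c hcm hcM hc using fun m : ℕ =>
    exists_euler_polygon hA hM hne x₀ (Nat.one_div_pos_of_nat (α := ℝ) (n := m))
  let 𝒰 : Ultrafilter ℕ := Filter.hyperfilter ℕ
  have h𝒰 : (𝒰 : Filter ℕ) ≤ atTop := Nat.hyperfilter_le_atTop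
  have hlim : ∀ t, ∃ x, Tendsto (fun m => x₀ + ∫ q in (0 : ℝ)..t, A q (c m q)) 𝒰 (𝓝 x) := by
    intro t
    obtain ⟨x, -, hx⟩ := (isCompact_closedBall x₀
      (M * dist (∫ r in (0 : ℝ)..t, ‖A r‖) (∫ r in (0 : ℝ)..0, ‖A r‖))).ultrafilter_le_nhds
      (𝒰.map fun m => x₀ + ∫ q in (0 : ℝ)..t, A q (c m q))
      (le_principal_iff.2 (Ultrafilter.mem_coe.2 (Ultrafilter.mem_map.2 (univ_mem' fun m => by
        simpa using dist_integral_clm_apply_le hA (hcm m) (hcM m) x₀ 0 t))))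
    exact ⟨x, hx⟩
  choose X hX using hlim
  have hmod : ∀ s t, dist (X s) (X t) ≤
      M * dist (∫ r in (0 : ℝ)..s, ‖A r‖) (∫ r in (0 : ℝ)..t, ‖A r‖) := fun s t =>
    le_of_tendsto ((hX s).dist (hX t)) (Eventually.of_forall fun m =>
      dist_integral_clm_apply_le hA (hcm m) (hcM m) x₀ t s)
  have hac : ∀ T : ℝ, AbsolutelyContinuousOnInterval X 0 T := fun T =>
    (IntervalIntegrable.absolutelyContinuousOnInterval_intervalIntegral
      (hA.intervalIntegrable_of_real 0 T).norm left_mem_uIcc).of_dist_le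
      fun s _ t _ => hmod s t
  refine ⟨X, ⟨fun T _ => hac T, ?_⟩, ?_⟩
  · have hdiff : ∀ᵐ t : ℝ, ∀ T : ℕ, t ∈ uIcc (0 : ℝ) T → DifferentiableAt ℝ X t :=
      ae_all_iff.2 fun T => (hac T).boundedVariationOn.ae_differentiableAt_of_mem_uIcc
    filter_upwards [hdiff, ae_tendsto_integral_norm_sub_div hA] with t hdt hleb ht
    obtain ⟨T, hT⟩ := exists_nat_ge t
    have hd := (hdt T (mem_uIcc_of_le ht hT)).hasDerivAt
    exact ⟨_, mem_image_of_tendsto_of_hasDerivAt (𝒰 := (𝒰 : Filter ℕ)) hA hM hconv hcl husc hcm hcM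
      (tendsto_one_div_add_atTop_nhds_zero_nat.mono_left h𝒰) hc hX ht hleb hd, hd⟩
  · refine tendsto_nhds_unique (hX 0) ?_
    simp

end Existence

/-! ### Marginal costs and link responses -/

section Network

variable {d n : ℕ} {f : Fin n → EuclideanSpace ℝ (Fin d) → ℝ} {a : Fin n → ℝ}
  {W : ℝ → Matrix (Fin n) (Fin n) ℝ} {g : EuclideanSpace ℝ (Fin d) → EuclideanSpace ℝ (Fin d)}

/-- Arrays of vectors indexed by ordered pairs of agents: one response for each link. -/
abbrev LinkArray (d n : ℕ) : Type := Fin n → Fin n → EuclideanSpace ℝ (Fin d)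

/-- The scaled marginal cost `∇fᵢ(xᵢ) / aᵢ` of agent `i` at the state `X`. -/
noncomputable def marginalCost (f : Fin n → EuclideanSpace ℝ (Fin d) → ℝ) (a : Fin n → ℝ)
    (X : AllocState d n) (i : Fin n) : EuclideanSpace ℝ (Fin d) :=
  (a i)⁻¹ • gradient (f i) (X i)

/-- The responses `g (zᵢ - zⱼ)` of the links to the differences of the marginal costs `z`. -/
noncomputable def linkResponse (f : Fin n → EuclideanSpace ℝ (Fin d) → ℝ) (a : Fin n → ℝ)
    (g : EuclideanSpace ℝ (Fin d) → EuclideanSpace ℝ (Fin d)) (X : AllocState d n) :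
    LinkArray d n :=
  fun i j => g (marginalCost f a X i - marginalCost f a X j)

/-- The velocity of the state which is produced by link responses `η` over links of weights `w`.
It is linear in `η`, so that the Filippov regularization of the dynamics is the image of the
essential hull of the link responses, which does not depend on time. -/
noncomputable def netFlow (a : Fin n → ℝ) (w : Matrix (Fin n) (Fin n) ℝ) :
    LinkArray d n →L[ℝ] AllocState d n :=
  ContinuousLinearMap.pi fun i => -(a i)⁻¹ • ∑ j, w i j •
    (ContinuousLinearMap.proj j ∘L ContinuousLinearMap.proj i :
      LinkArray d n →L[ℝ] EuclideanSpace ℝ (Fin d))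

lemma netFlow_apply (a : Fin n → ℝ) (w : Matrix (Fin n) (Fin n) ℝ) (η : LinkArray d n)
    (i : Fin n) : netFlow a w η i = -(a i)⁻¹ • ∑ j, w i j • η i j := by
  simp [netFlow]

/-- Summation by parts over the links. -/
lemma sum_inner_netFlow (ha : ∀ i, a i ≠ 0) {w : Matrix (Fin n) (Fin n) ℝ} (hw : w.IsSymm)
    {η : LinkArray d n} (hη : ∀ i j, η i j = -η j i) (u : AllocState d n) :
    ∑ i, a i * inner ℝ (u i) (netFlow a w η i) =
      -(1 / 2) * ∑ i, ∑ j, w i j * inner ℝ (u i - u j) (η i j) := by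
  have h1 : ∀ i, a i * inner ℝ (u i) (netFlow a w η i) =
      -∑ j, w i j * inner ℝ (u i) (η i j) := by
    intro i
    rw [netFlow_apply, inner_smul_right, inner_sum]
    simp only [inner_smul_right]
    have := ha i
    field_simp
  have h2 : ∑ i, ∑ j, w i j * inner ℝ (u j) (η i j) =
      -∑ i, ∑ j, w i j * inner ℝ (u i) (η i j) := by
    rw [Finset.sum_comm, ← Finset.sum_neg_distrib]
    refine Finset.sum_congr rfl fun i _ => ?_
    rw [← Finset.sum_neg_distrib]
    refine Finset.sum_congr rfl fun j _ => ?_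
    rw [hw.apply i j, hη j i, inner_neg_right]
    ring
  simp only [h1, inner_sub_left, mul_sub, Finset.sum_sub_distrib, h2, Finset.sum_neg_distrib]
  ring

lemma continuous_marginalCost (hconv : ∀ i, StrictConvexOn ℝ univ (f i))
    (hdiff : ∀ i, Differentiable ℝ (f i)) (i : Fin n) :
    Continuous fun X => marginalCost f a X i := by
  have h := (hconv i).convexOn.continuous_gradient (hdiff i)
  unfold marginalCost
  fun_prop

lemma continuous_staticCost (hdiff : ∀ i, Differentiable ℝ (f i)) : Continuous (staticCost f) :=
  continuous_finsetSum _ fun i _ => (hdiff i).continuous.comp (continuous_apply i)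

lemma locallyLipschitz_staticCost (hconv : ∀ i, StrictConvexOn ℝ univ (f i)) :
    LocallyLipschitz (staticCost f) := by
  have hsum : ConvexOn ℝ univ (staticCost f) := by
    have h : ∀ i ∈ (Finset.univ : Finset (Fin n)),
        ConvexOn ℝ univ (fun X : AllocState d n => f i (X i)) := fun i _ =>
      (hconv i).convexOn.comp_linearMap
        (LinearMap.proj (R := ℝ) (φ := fun _ : Fin n => EuclideanSpace ℝ (Fin d)) i)
    refine ⟨convex_univ, fun X hX Y hY α β hα hβ hαβ => ?_⟩
    simp only [staticCost, Finset.smul_sum, ← Finset.sum_add_distrib]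
    exact Finset.sum_le_sum fun i hi => (h i hi).2 hX hY hα hβ hαβ
  exact hsum.locallyLipschitz

/-- The first-order condition for the total cost, strict away from the base point. -/
lemma staticCost_add_sum_inner_lt (hconv : ∀ i, StrictConvexOn ℝ univ (f i))
    (hdiff : ∀ i, Differentiable ℝ (f i)) (ha : ∀ i, a i ≠ 0) {X Y : AllocState d n}
    (hXY : X ≠ Y) :
    staticCost f X + ∑ i, a i * inner ℝ (marginalCost f a X i) (Y i - X i) < staticCost f Y := by
  have hterm : ∀ i, a i * inner ℝ (marginalCost f a X i) (Y i - X i) =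
      inner ℝ (gradient (f i) (X i)) (Y i - X i) := fun i => by
    rw [marginalCost, real_inner_smul_left, mul_inv_cancel_left₀ (ha i)]
  simp only [hterm, staticCost, ← Finset.sum_add_distrib]
  obtain ⟨i₀, hi₀⟩ := Function.ne_iff.1 hXY
  exact Finset.sum_lt_sum
    (fun i _ => (hconv i).convexOn.add_inner_gradient_le (hdiff i _) _)
    ⟨i₀, Finset.mem_univ _, (hconv i₀).add_inner_gradient_lt (hdiff i₀ _) hi₀⟩

lemma hasDerivAt_staticCost_comp (hdiff : ∀ i, Differentiable ℝ (f i)) (ha : ∀ i, a i ≠ 0)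
    {X : ℝ → AllocState d n} {v : AllocState d n} {t : ℝ} (hX : HasDerivAt X v t) :
    HasDerivAt (fun r => staticCost f (X r))
      (∑ i, a i * inner ℝ (marginalCost f a (X t) i) (v i)) t := by
  refine HasDerivAt.fun_sum fun i _ => ?_
  have h := (hdiff i (X t i)).hasGradientAt.hasFDerivAt.comp_hasDerivAt t (hasDerivAt_pi.1 hX i)
  rw [marginalCost, real_inner_smul_left, mul_inv_cancel_left₀ (ha i)]
  exact h

/-- Array-valued maps of the state which are antisymmetric and whose entries have, in the weak
sense, the signs of the corresponding differences of marginal costs. -/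
structure IsLinkResponse (f : Fin n → EuclideanSpace ℝ (Fin d) → ℝ) (a : Fin n → ℝ)
    (G : AllocState d n → LinkArray d n) : Prop where
  antisymm : ∀ X i j, G X i j = -G X j i
  nonneg : ∀ X i j p, 0 < (marginalCost f a X i - marginalCost f a X j) p → 0 ≤ G X i j p

lemma isLinkResponse_linkResponse (hg : IsStronglySignPreserving g) :
    IsLinkResponse f a (linkResponse f a g) where
  antisymm X i j := by rw [linkResponse, linkResponse, ← hg.odd, neg_sub]
  nonneg X i j p h := (hg.pos _ p h).le

lemma IsLinkResponse.indicator {G : AllocState d n → LinkArray d n} (hG : IsLinkResponse f a G)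
    (S : Set (AllocState d n)) : IsLinkResponse f a (S.indicator G) where
  antisymm X i j := by
    by_cases hX : X ∈ S
    · simpa [hX] using hG.antisymm X i j
    · simp [hX]
  nonneg X i j p h := by
    by_cases hX : X ∈ S
    · simpa [hX] using hG.nonneg X i j p h
    · simp [hX]

lemma IsLinkResponse.antisymm_of_mem_essHull {G : AllocState d n → LinkArray d n}
    (hG : IsLinkResponse f a G) {X : AllocState d n} {η : LinkArray d n} (hη : η ∈ essHull G X)
    (i j : Fin n) : η i j = -η j i := by
  have hcl : IsClosed {η : LinkArray d n | η i j + η j i = 0} :=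
    isClosed_eq (by fun_prop) continuous_const
  have hcv : Convex ℝ {η : LinkArray d n | η i j + η j i = 0} := by
    intro x hx y hy α β _ _ _
    simp only [mem_ofPred_eq, Pi.add_apply, Pi.smul_apply] at hx hy ⊢
    rw [add_add_add_comm, ← smul_add, ← smul_add, hx, hy]
    simp
  have h : η i j + η j i = 0 := essHull_subset_of_eventually hcl hcv
    (Eventually.of_forall fun Y => by simp [hG.antisymm Y i j]) hη
  exact eq_neg_of_add_eq_zero_left h

lemma le_apply_of_mem_essHull {G : AllocState d n → LinkArray d n} {X : AllocState d n}
    {i j : Fin n} {p : Fin d} {κ : ℝ} (h : ∀ᶠ Y in 𝓝 X, κ ≤ G Y i j p) {η : LinkArray d n}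
    (hη : η ∈ essHull G X) : κ ≤ η i j p := by
  have hcl : IsClosed {η : LinkArray d n | κ ≤ η i j p} :=
    isClosed_le continuous_const (by fun_prop)
  have hcv : Convex ℝ {η : LinkArray d n | κ ≤ η i j p} := by
    intro x hx y hy α β hα hβ hαβ
    simp only [mem_ofPred_eq, Pi.add_apply, Pi.smul_apply, PiLp.add_apply, PiLp.smul_apply,
      smul_eq_mul] at hx hy ⊢
    calc κ = α * κ + β * κ := by rw [← add_mul, hαβ, one_mul]
      _ ≤ _ := by gcongr
  exact essHull_subset_of_eventually hcl hcv h hη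

/-- The entries of the essential hull still have the signs of the differences of marginal costs,
entry by entry. -/
lemma IsLinkResponse.mul_nonneg_of_mem_essHull {G : AllocState d n → LinkArray d n}
    (hG : IsLinkResponse f a G) (hz : ∀ i, Continuous fun X => marginalCost f a X i)
    {X : AllocState d n} {η : LinkArray d n} (hη : η ∈ essHull G X) (i j : Fin n) (p : Fin d) :
    0 ≤ (marginalCost f a X i - marginalCost f a X j) p * η i j p := by
  have key : ∀ i j, 0 < (marginalCost f a X i - marginalCost f a X j) p → 0 ≤ η i j p := by
    intro i j hpos
    have hc : Continuous fun Y => (marginalCost f a Y i - marginalCost f a Y j) p := by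
      have h1 := hz i
      have h2 := hz j
      fun_prop
    refine le_apply_of_mem_essHull ?_ hη
    filter_upwards [(hc.tendsto X).eventually (lt_mem_nhds hpos)] with Y hY
    exact hG.nonneg Y i j p hY
  rcases lt_trichotomy ((marginalCost f a X i - marginalCost f a X j) p) 0 with h | h | h
  · have h' : 0 < (marginalCost f a X j - marginalCost f a X i) p := by
      simp only [PiLp.sub_apply] at h ⊢
      linarith
    refine mul_nonneg_of_nonpos_of_nonpos h.le ?_
    rw [hG.antisymm_of_mem_essHull hη i j, PiLp.neg_apply]
    linarith [key j i h']
  · rw [h, zero_mul]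
  · exact mul_nonneg h.le (key i j h)

lemma inner_eq_sum_mul (x y : EuclideanSpace ℝ (Fin d)) : inner ℝ x y = ∑ p, x p * y p := by
  simp [PiLp.inner_apply, mul_comm]

lemma IsLinkResponse.inner_nonneg_of_mem_essHull {G : AllocState d n → LinkArray d n}
    (hG : IsLinkResponse f a G) (hz : ∀ i, Continuous fun X => marginalCost f a X i)
    {X : AllocState d n} {η : LinkArray d n} (hη : η ∈ essHull G X) (i j : Fin n) :
    0 ≤ inner ℝ (marginalCost f a X i - marginalCost f a X j) (η i j) := by
  rw [inner_eq_sum_mul]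
  exact Finset.sum_nonneg fun p _ => hG.mul_nonneg_of_mem_essHull hz hη i j p

/-- A link between agents of different marginal costs dissipates at a rate which is bounded below
near the given state. This is where the nonlinearity has to stay away from zero. -/
lemma exists_pos_le_inner (hg : IsStronglySignPreserving g)
    (hz : ∀ i, Continuous fun X => marginalCost f a X i) {X : AllocState d n} {i j : Fin n}
    (hij : marginalCost f a X i ≠ marginalCost f a X j) :
    ∃ κ > 0, ∀ᶠ Y in 𝓝 X, ∀ η ∈ essHull (linkResponse f a g) Y,
      κ ≤ inner ℝ (marginalCost f a Y i - marginalCost f a Y j) (η i j) := by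
  have hG := isLinkResponse_linkResponse (f := f) (a := a) hg
  have key : ∀ i j p, 0 < (marginalCost f a X i - marginalCost f a X j) p →
      ∃ κ > 0, ∀ᶠ Y in 𝓝 X, ∀ η ∈ essHull (linkResponse f a g) Y,
        κ ≤ inner ℝ (marginalCost f a Y i - marginalCost f a Y j) (η i j) := by
    intro i j p hp
    have hc : Continuous fun Y => marginalCost f a Y i - marginalCost f a Y j := (hz i).sub (hz j)
    have hcp : Continuous fun Y => (marginalCost f a Y i - marginalCost f a Y j) p := by fun_prop
    obtain ⟨c, hc0, hcg⟩ := hg.locally_away _ p hp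
    have h1 : ∀ᶠ Y in 𝓝 X, c ≤ linkResponse f a g Y i j p := (hc.tendsto X).eventually hcg
    refine ⟨(marginalCost f a X i - marginalCost f a X j) p / 2 * c, by positivity, ?_⟩
    filter_upwards [eventually_eventually_nhds.2 h1,
      (hcp.tendsto X).eventually (lt_mem_nhds (half_lt_self hp))] with Y hY1 hY2 η hη
    rw [inner_eq_sum_mul]
    refine le_trans ?_ (Finset.single_le_sum
      (fun q _ => hG.mul_nonneg_of_mem_essHull hz hη i j q) (Finset.mem_univ p))
    exact mul_le_mul hY2.le (le_apply_of_mem_essHull hY1 hη) hc0.le ((half_pos hp).trans hY2).le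
  obtain ⟨p, hp⟩ : ∃ p, (marginalCost f a X i - marginalCost f a X j) p ≠ 0 := by
    by_contra! h
    exact hij (sub_eq_zero.1 (PiLp.ext h))
  rcases hp.lt_or_gt with h | h
  · obtain ⟨κ, hκ, hev⟩ := key j i p (by
      simp only [PiLp.sub_apply] at h ⊢
      linarith)
    refine ⟨κ, hκ, hev.mono fun Y hY η hη => (hY η hη).trans_eq ?_⟩
    rw [hG.antisymm_of_mem_essHull hη j i, inner_neg_right, ← inner_neg_left, neg_sub]
  · exact key i j p h

/-- The lower bound on the dissipation of a link is uniform on compact sets. -/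
lemma exists_pos_forall_le_inner (hg : IsStronglySignPreserving g)
    (hz : ∀ i, Continuous fun X => marginalCost f a X i) {C : Set (AllocState d n)}
    (hC : IsCompact C) (i j : Fin n) {ρ : ℝ} (hρ : 0 < ρ) :
    ∃ κ > 0, ∀ X ∈ C, ρ ≤ ‖marginalCost f a X i - marginalCost f a X j‖ →
      ∀ η ∈ essHull (linkResponse f a g) X,
        κ ≤ inner ℝ (marginalCost f a X i - marginalCost f a X j) (η i j) := by
  have hcpt : IsCompact (C ∩ {X | ρ ≤ ‖marginalCost f a X i - marginalCost f a X j‖}) :=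
    hC.inter_right (isClosed_le continuous_const ((hz i).sub (hz j)).norm)
  suffices ∃ κ > 0, ∀ X ∈ C ∩ {X | ρ ≤ ‖marginalCost f a X i - marginalCost f a X j‖},
      ∀ η ∈ essHull (linkResponse f a g) X,
        κ ≤ inner ℝ (marginalCost f a X i - marginalCost f a X j) (η i j) by
    obtain ⟨κ, hκ, h⟩ := this
    exact ⟨κ, hκ, fun X hX hXρ => h X ⟨hX, hXρ⟩⟩
  refine hcpt.induction_on (p := fun S => ∃ κ > 0, ∀ X ∈ S,
      ∀ η ∈ essHull (linkResponse f a g) X,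
        κ ≤ inner ℝ (marginalCost f a X i - marginalCost f a X j) (η i j))
    ⟨1, one_pos, by simp⟩ ?_ ?_ ?_
  · rintro S T hST ⟨κ, hκ, h⟩
    exact ⟨κ, hκ, fun X hX => h X (hST hX)⟩
  · rintro S T ⟨κ, hκ, h⟩ ⟨κ', hκ', h'⟩
    refine ⟨min κ κ', lt_min hκ hκ', fun X hX η hη => ?_⟩
    rcases hX with hX | hX
    · exact (min_le_left _ _).trans (h X hX η hη)
    · exact (min_le_right _ _).trans (h' X hX η hη)
  · rintro X ⟨-, hX⟩
    have hne : marginalCost f a X i ≠ marginalCost f a X j := by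
      intro h
      simp only [mem_ofPred_eq, h, sub_self, norm_zero] at hX
      linarith
    obtain ⟨κ, hκ, hev⟩ := exists_pos_le_inner hg hz hne
    exact ⟨_, mem_nhdsWithin_of_mem_nhds hev, κ, hκ, fun Y hY => hY⟩

lemma eventually_norm_linkResponse_le (hg : IsStronglySignPreserving g)
    (hz : ∀ i, Continuous fun X => marginalCost f a X i) (X : AllocState d n) :
    ∃ M : ℝ, ∀ᶠ Y in 𝓝 X, ‖linkResponse f a g Y‖ ≤ M := by
  choose M hM using fun i j => hg.locally_bounded (marginalCost f a X i - marginalCost f a X j)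
  have hev : ∀ᶠ Y in 𝓝 X, ∀ i j, ‖linkResponse f a g Y i j‖ ≤ M i j :=
    eventually_all.2 fun i => eventually_all.2 fun j =>
      (((hz i).sub (hz j)).tendsto X).eventually (hM i j)
  refine ⟨∑ i, ∑ j, |M i j|, hev.mono fun Y hY => ?_⟩
  have h0 : ∀ i, 0 ≤ ∑ j, |M i j| := fun i => Finset.sum_nonneg fun _ _ => abs_nonneg _
  refine (pi_norm_le_iff_of_nonneg (Finset.sum_nonneg fun i _ => h0 i)).2 fun i => ?_
  refine le_trans ?_ (Finset.single_le_sum (fun i _ => h0 i) (Finset.mem_univ i))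
  refine (pi_norm_le_iff_of_nonneg (h0 i)).2 fun j => ?_
  exact ((hY i j).trans (le_abs_self _)).trans
    (Finset.single_le_sum (f := fun j => |M i j|) (fun j _ => abs_nonneg _) (Finset.mem_univ j))

lemma exists_forall_norm_linkResponse_le (hg : IsStronglySignPreserving g)
    (hz : ∀ i, Continuous fun X => marginalCost f a X i) {C : Set (AllocState d n)}
    (hC : IsCompact C) : ∃ M : ℝ, 0 ≤ M ∧ ∀ X ∈ C, ∀ᶠ Y in 𝓝 X, ‖linkResponse f a g Y‖ ≤ M := by
  refine hC.induction_on (p := fun S => ∃ M : ℝ, 0 ≤ M ∧ ∀ X ∈ S, ∀ᶠ Y in 𝓝 X,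
    ‖linkResponse f a g Y‖ ≤ M) ⟨0, le_rfl, by simp⟩ ?_ ?_ ?_
  · rintro S T hST ⟨M, hM0, hM⟩
    exact ⟨M, hM0, fun X hX => hM X (hST hX)⟩
  · rintro S T ⟨M, hM0, hM⟩ ⟨M', -, hM'⟩
    refine ⟨max M M', le_max_of_le_left hM0, fun X hX => ?_⟩
    rcases hX with hX | hX
    · exact (hM X hX).mono fun Y hY => hY.trans (le_max_left _ _)
    · exact (hM' X hX).mono fun Y hY => hY.trans (le_max_right _ _)
  · intro X _
    obtain ⟨M, hM⟩ := eventually_norm_linkResponse_le hg hz X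
    refine ⟨_, mem_nhdsWithin_of_mem_nhds (eventually_eventually_nhds.2 hM), M, ?_, fun Y hY => hY⟩
    exact (norm_nonneg _).trans hM.self_of_nhds

lemma norm_le_of_mem_essHull {G : AllocState d n → LinkArray d n} {X : AllocState d n} {M : ℝ}
    (h : ∀ᶠ Y in 𝓝 X, ‖G Y‖ ≤ M) {η : LinkArray d n} (hη : η ∈ essHull G X) : ‖η‖ ≤ M :=
  mem_closedBall_zero_iff.1 (essHull_subset_of_eventually Metric.isClosed_closedBall
    (convex_closedBall _ _) (h.mono fun _ hY => mem_closedBall_zero_iff.2 hY) hη)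

/-- The Filippov regularization of the dynamics is the image of the essential hull of the link
responses under the linear map `netFlow`. -/
lemma laplacianGradientInclusion_eq (hg : IsStronglySignPreserving g)
    (hz : ∀ i, Continuous fun X => marginalCost f a X i) (t : ℝ) (X : AllocState d n) :
    laplacianGradientInclusion f a W g t X =
      netFlow a (W t) '' essHull (linkResponse f a g) X := by
  obtain ⟨M, hM⟩ := eventually_norm_linkResponse_le hg hz X
  rw [← essHull_clm_comp (netFlow a (W t)) hM]
  have : laplacianGradientField f a W g t =
      fun Y => netFlow a (W t) (linkResponse f a g Y) := by
    funext Y i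
    rw [netFlow_apply]
    rfl
  rw [laplacianGradientInclusion, this]
  rfl

end Network

/-! ### Dissipation and displacement along solutions -/

section Trajectories

variable {d n : ℕ} {f : Fin n → EuclideanSpace ℝ (Fin d) → ℝ} {a : Fin n → ℝ}
  {W : ℝ → Matrix (Fin n) (Fin n) ℝ} {g : EuclideanSpace ℝ (Fin d) → EuclideanSpace ℝ (Fin d)}
  {G : AllocState d n → LinkArray d n} {X : ℝ → AllocState d n}

lemma IsUniformlyConnectedNetwork.intervalIntegrable (hW : IsUniformlyConnectedNetwork W)
    (i j : Fin n) {s t : ℝ} (hs : 0 ≤ s) (hst : s ≤ t) :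
    IntervalIntegrable (fun r => W r i j) volume s t :=
  (intervalIntegrable_iff_integrableOn_Icc_of_le hst).2
    ((hW.integrable i j t).mono_set (Icc_subset_Icc_left hs))

lemma IsUniformlyConnectedNetwork.integral_nonneg (hW : IsUniformlyConnectedNetwork W)
    (i j : Fin n) {s t : ℝ} (hs : 0 ≤ s) (hst : s ≤ t) : 0 ≤ ∫ r in s..t, W r i j :=
  intervalIntegral.integral_nonneg hst fun r hr => hW.nonneg r (hs.trans hr.1) i j

lemma IsUniformlyConnectedNetwork.integral_mono (hW : IsUniformlyConnectedNetwork W)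
    (i j : Fin n) {s r t : ℝ} (hs : 0 ≤ s) (hsr : s ≤ r) (hrt : r ≤ t) :
    ∫ q in s..r, W q i j ≤ ∫ q in s..t, W q i j := by
  rw [← intervalIntegral.integral_add_adjacent_intervals (hW.intervalIntegrable i j hs hsr)
    (hW.intervalIntegrable i j (hs.trans hsr) hrt)]
  linarith [hW.integral_nonneg i j (hs.trans hsr) hrt]

lemma IsInclusionSolution.absolutelyContinuousOnInterval {E : Type*} [NormedAddCommGroup E]
    [NormedSpace ℝ E] {F : ℝ → E → Set E} {X : ℝ → E} (hX : IsInclusionSolution F X) {s t : ℝ}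
    (hs : 0 ≤ s) (hst : s ≤ t) : AbsolutelyContinuousOnInterval X s t := by
  refine (hX.1 t (hs.trans hst)).mono ?_
  rw [uIcc_of_le hst, uIcc_of_le (hs.trans hst)]
  exact Icc_subset_Icc_left hs

lemma Finset.exists_pos_forall_le {ι : Type*} (J : Finset ι) (φ : ι → ℝ)
    (h : ∀ e ∈ J, 0 < φ e) : ∃ ε > 0, ∀ e ∈ J, ε ≤ φ e := by
  have hev : ∀ᶠ ε in 𝓝[>] (0 : ℝ), ∀ e ∈ J, ε ≤ φ e := (Finset.eventually_all J).2 fun e he =>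
    mem_nhdsWithin_of_mem_nhds (Iic_mem_nhds (h e he))
  obtain ⟨ε, hε, hε0⟩ := (hev.and self_mem_nhdsWithin).exists
  exact ⟨ε, hε0, hε⟩

/-- Over a link whose dissipation rate is at least `κ`, the total cost decreases by at least
`κ / 2` times the accumulated weight. -/
lemma staticCost_add_integral_le (hconv : ∀ i, StrictConvexOn ℝ univ (f i))
    (hdiff : ∀ i, Differentiable ℝ (f i)) (ha : ∀ i, a i ≠ 0)
    (hW : IsUniformlyConnectedNetwork W) (hG : IsLinkResponse f a G)
    (hX : IsInclusionSolution (fun t x => netFlow a (W t) '' essHull G x) X)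
    {s t : ℝ} (hs : 0 ≤ s) (hst : s ≤ t) (i j : Fin n) {κ : ℝ}
    (hκ : ∀ r ∈ Icc s t, ∀ η ∈ essHull G (X r),
      κ ≤ inner ℝ (marginalCost f a (X r) i - marginalCost f a (X r) j) (η i j)) :
    staticCost f (X t) + κ / 2 * ∫ r in s..t, W r i j ≤ staticCost f (X s) := by
  have hz := fun i => continuous_marginalCost (a := a) hconv hdiff i
  have hac := (locallyLipschitz_staticCost hconv).comp_absolutelyContinuousOnInterval
    (hX.absolutelyContinuousOnInterval hs hst)
  have h := hac.sub_le_integral hst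
    ((hW.intervalIntegrable i j hs hst).const_mul (-(κ / 2))) ?_
  · rw [intervalIntegral.integral_const_mul] at h
    linarith
  filter_upwards [hX.2] with r hr hrm
  have hr0 : 0 ≤ r := hs.trans hrm.1
  obtain ⟨_, ⟨η, hη, rfl⟩, hv⟩ := hr hr0
  refine ⟨_, hasDerivAt_staticCost_comp hdiff ha hv, ?_⟩
  rw [sum_inner_netFlow ha (hW.symm r hr0) (hG.antisymm_of_mem_essHull hη)]
  have hterm : ∀ i j, 0 ≤ W r i j *
      inner ℝ (marginalCost f a (X r) i - marginalCost f a (X r) j) (η i j) := fun i j =>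
    mul_nonneg (hW.nonneg r hr0 i j) (hG.inner_nonneg_of_mem_essHull hz hη i j)
  have h1 := Finset.single_le_sum
    (f := fun i => ∑ j, W r i j *
      inner ℝ (marginalCost f a (X r) i - marginalCost f a (X r) j) (η i j))
    (fun i _ => Finset.sum_nonneg fun j _ => hterm i j) (Finset.mem_univ i)
  have h2 := Finset.single_le_sum
    (f := fun j => W r i j *
      inner ℝ (marginalCost f a (X r) i - marginalCost f a (X r) j) (η i j))
    (fun j _ => hterm i j) (Finset.mem_univ j)
  have h3 := mul_le_mul_of_nonneg_left (hκ r hrm η hη) (hW.nonneg r hr0 i j)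
  beta_reduce at h1 h2
  linarith

lemma staticCost_antitone (hconv : ∀ i, StrictConvexOn ℝ univ (f i))
    (hdiff : ∀ i, Differentiable ℝ (f i)) (ha : ∀ i, a i ≠ 0)
    (hW : IsUniformlyConnectedNetwork W) (hG : IsLinkResponse f a G)
    (hX : IsInclusionSolution (fun t x => netFlow a (W t) '' essHull G x) X)
    {s t : ℝ} (hs : 0 ≤ s) (hst : s ≤ t) : staticCost f (X t) ≤ staticCost f (X s) := by
  rcases isEmpty_or_nonempty (Fin n) with hn | ⟨⟨i⟩⟩
  · simp [staticCost]
  · have h := staticCost_add_integral_le hconv hdiff ha hW hG hX hs hst i i (κ := 0) fun r _ η _ => by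
      simp
    simpa using h

/-- The displacement in a direction `u` which is constant along the links in `J` is caused by the
other links only. -/
lemma sum_inner_sub_le (ha : ∀ i, a i ≠ 0) (hW : IsUniformlyConnectedNetwork W)
    (hG : IsLinkResponse f a G)
    (hX : IsInclusionSolution (fun t x => netFlow a (W t) '' essHull G x) X)
    {s t : ℝ} (hs : 0 ≤ s) (hst : s ≤ t) {M : ℝ}
    (hM : ∀ r ∈ Icc s t, ∀ η ∈ essHull G (X r), ‖η‖ ≤ M) (J : Finset (Fin n × Fin n))
    {u : AllocState d n} (hu : ∀ e ∈ J, u e.1 = u e.2) :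
    ∑ i, a i * inner ℝ (u i) (X t i - X s i) ≤
      (∑ e ∈ Jᶜ, ∫ r in s..t, W r e.1 e.2) * (M * ‖u‖) := by
  let φ : AllocState d n →L[ℝ] ℝ := ∑ i, a i • (innerSL ℝ (u i)) ∘L ContinuousLinearMap.proj i
  have hφ : ∀ Y, φ Y = ∑ i, a i * inner ℝ (u i) (Y i) := fun Y => by
    simp [φ]
  have hac : AbsolutelyContinuousOnInterval (fun r => φ (X r)) s t :=
    φ.lipschitz.locallyLipschitz.comp_absolutelyContinuousOnInterval
      (hX.absolutelyContinuousOnInterval hs hst)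
  have hint : ∀ e ∈ Jᶜ, IntervalIntegrable (fun r => W r e.1 e.2) volume s t :=
    fun e _ => hW.intervalIntegrable e.1 e.2 hs hst
  have hB : IntervalIntegrable (fun r => (∑ e ∈ Jᶜ, W r e.1 e.2) * (M * ‖u‖)) volume s t := by
    refine IntervalIntegrable.mul_const ?_ _
    have h := IntervalIntegrable.sum _ hint
    rwa [show (∑ e ∈ Jᶜ, fun r => W r e.1 e.2) = fun r => ∑ e ∈ Jᶜ, W r e.1 e.2 from
      funext fun r => Finset.sum_apply r _ _] at h
  have h := hac.sub_le_integral hst hB ?_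
  · rw [intervalIntegral.integral_mul_const, intervalIntegral.integral_finsetSum hint,
      ← map_sub, hφ] at h
    exact h
  filter_upwards [hX.2] with r hr hrm
  have hr0 : 0 ≤ r := hs.trans hrm.1
  obtain ⟨_, ⟨η, hη, rfl⟩, hv⟩ := hr hr0
  refine ⟨_, φ.hasFDerivAt.comp_hasDerivAt r hv, ?_⟩
  rw [hφ, sum_inner_netFlow ha (hW.symm r hr0) (hG.antisymm_of_mem_essHull hη),
    ← Fintype.sum_prod_type' (f := fun i j => W r i j * inner ℝ (u i - u j) (η i j)),
    ← Finset.sum_add_sum_compl J, Finset.sum_eq_zero (s := J) fun e he => by simp [hu e he],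
    zero_add, Finset.mul_sum, Finset.sum_mul]
  refine Finset.sum_le_sum fun e _ => ?_
  have h1 : -(1 / 2) * inner ℝ (u e.1 - u e.2) (η e.1 e.2) ≤ M * ‖u‖ := by
    have h2 := neg_le_of_abs_le (abs_real_inner_le_norm (u e.1 - u e.2) (η e.1 e.2))
    have h3 : ‖u e.1 - u e.2‖ ≤ ‖u‖ + ‖u‖ :=
      (norm_sub_le _ _).trans (add_le_add (norm_le_pi_norm u _) (norm_le_pi_norm u _))
    have h4 : ‖η e.1 e.2‖ ≤ M :=
      ((norm_le_pi_norm (η e.1) e.2).trans (norm_le_pi_norm η e.1)).trans (hM r hrm η hη)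
    have h5 := mul_le_mul h3 h4 (norm_nonneg _) (by positivity)
    linarith
  have h6 := mul_le_mul_of_nonneg_left h1 (hW.nonneg r hr0 e.1 e.2)
  linarith

/-- Feasibility is preserved, since link responses are antisymmetric. -/
lemma mem_feasibleSet_of_isInclusionSolution (ha : ∀ i, a i ≠ 0)
    (hW : IsUniformlyConnectedNetwork W) (hG : IsLinkResponse f a G)
    (hX : IsInclusionSolution (fun t x => netFlow a (W t) '' essHull G x) X)
    {b : EuclideanSpace ℝ (Fin d)} (h0 : X 0 ∈ feasibleSet a b) {t : ℝ} (ht : 0 ≤ t) :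
    X t ∈ feasibleSet a b := by
  let Ψ : AllocState d n →L[ℝ] EuclideanSpace ℝ (Fin d) :=
    ∑ i, a i • ContinuousLinearMap.proj i
  have hΨ : ∀ Y, Ψ Y = ∑ i, a i • Y i := fun Y => by simp [Ψ]
  have hac : AbsolutelyContinuousOnInterval (fun r => Ψ (X r)) 0 t :=
    Ψ.lipschitz.locallyLipschitz.comp_absolutelyContinuousOnInterval (hX.1 t ht)
  obtain ⟨c, hc⟩ := hac.const_of_ae_hasDerivAt_zero (by
    filter_upwards [hX.2] with r hr hrm
    rw [uIcc_of_le ht] at hrm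
    obtain ⟨_, ⟨η, hη, rfl⟩, hv⟩ := hr hrm.1
    have hzero : Ψ (netFlow a (W r) η) = 0 := by
      refine ext_inner_left ℝ fun v => ?_
      have h := sum_inner_netFlow ha (hW.symm r hrm.1) (hG.antisymm_of_mem_essHull hη)
        fun _ => v
      simpa [hΨ, inner_sum, inner_smul_right] using h
    have h := Ψ.hasFDerivAt.comp_hasDerivAt r hv
    rwa [hzero] at h)
  have h1 := hc 0 left_mem_uIcc
  have h2 := hc t right_mem_uIcc
  simp only [hΨ] at h1 h2
  exact (h2.trans h1.symm).trans h0

/-- If the state `x` is nearly in consensus over the links in `J`, then it is nearly optimal among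
the states which are accessible from `x` through these links. A state `y` which is nearly
accessible and not more expensive is therefore close to `x`. -/
lemma exists_dist_le_of_near_consensus (hconv : ∀ i, StrictConvexOn ℝ univ (f i))
    (hdiff : ∀ i, Differentiable ℝ (f i)) (ha : ∀ i, a i ≠ 0) {C : Set (AllocState d n)}
    (hC : IsCompact C) (J : Finset (Fin n × Fin n)) {μ : ℝ} (hμ : 0 < μ) :
    ∃ ρ > 0, ∀ x ∈ C, ∀ y ∈ C, staticCost f y ≤ staticCost f x →
      (∀ e ∈ J, ‖marginalCost f a x e.1 - marginalCost f a x e.2‖ ≤ ρ) →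
      (∀ u : AllocState d n, (∀ e ∈ J, u e.1 = u e.2) →
        ∑ i, a i * inner ℝ (u i) (y i - x i) ≤ ρ * ‖u‖) →
      dist x y ≤ μ := by
  have hz := fun i => continuous_marginalCost (a := a) hconv hdiff i
  by_contra! hne
  choose x hxC y hyC hle hcons hacc hdist using fun m : ℕ =>
    hne (1 / ((m : ℝ) + 1)) Nat.one_div_pos_of_nat
  obtain ⟨⟨x', y'⟩, -, φ, hφ, hlim⟩ :=
    (hC.prod hC).tendsto_subseq (x := fun m => (x m, y m)) fun m => ⟨hxC m, hyC m⟩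
  have hx : Tendsto (fun m => x (φ m)) atTop (𝓝 x') := (continuous_fst.tendsto _).comp hlim
  have hy : Tendsto (fun m => y (φ m)) atTop (𝓝 y') := (continuous_snd.tendsto _).comp hlim
  have hρ : Tendsto (fun m => 1 / ((φ m : ℝ) + 1)) atTop (𝓝 0) :=
    tendsto_one_div_add_atTop_nhds_zero_nat.comp hφ.tendsto_atTop
  have hle' : staticCost f y' ≤ staticCost f x' :=
    le_of_tendsto_of_tendsto' (((continuous_staticCost hdiff).tendsto _).comp hy)
      (((continuous_staticCost hdiff).tendsto _).comp hx) fun m => hle _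
  have hdist' : μ ≤ dist x' y' := ge_of_tendsto' (hx.dist hy) fun m => (hdist _).le
  have hne' : x' ≠ y' := dist_pos.1 (hμ.trans_le hdist')
  -- The limit is in exact consensus over `J`, so that its marginal costs serve as test direction.
  have hcons' : ∀ e ∈ J, marginalCost f a x' e.1 = marginalCost f a x' e.2 := by
    intro e he
    rw [← sub_eq_zero, ← norm_le_zero_iff]
    exact le_of_tendsto_of_tendsto' ((((hz e.1).sub (hz e.2)).norm.tendsto _).comp hx) hρ
      fun m => hcons _ e he
  have hgrad : ∑ i, a i * inner ℝ (-marginalCost f a x' i) (y' i - x' i) ≤ 0 := by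
    have hl : Tendsto (fun m => ∑ i, a i * inner ℝ (-marginalCost f a x' i)
        (y (φ m) i - x (φ m) i)) atTop
        (𝓝 (∑ i, a i * inner ℝ (-marginalCost f a x' i) (y' i - x' i))) :=
      tendsto_finsetSum _ fun i _ => (tendsto_const_nhds.inner
        ((tendsto_pi_nhds.1 hy i).sub (tendsto_pi_nhds.1 hx i))).const_mul _
    have hr := hρ.mul_const ‖fun i => -marginalCost f a x' i‖
    rw [zero_mul] at hr
    exact le_of_tendsto_of_tendsto' hl hr fun m =>
      hacc (φ m) (fun i => -marginalCost f a x' i) fun e he => by simp only [hcons' e he]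
  have hlt := staticCost_add_sum_inner_lt hconv hdiff ha hne'
  simp only [inner_neg_left, mul_neg, Finset.sum_neg_distrib] at hgrad
  linarith

/-- A small decrease of the cost forces a small displacement, however long the time interval is
and however often the links are active, provided that the links outside `J` carry little weight.
By induction on `J`: until all the links in `J` have been active, the displacement is small by
the case of a smaller set of links. As each active link is near consensus at some time, all the
links in `J` are near consensus at the initial time, and the state remains close to the minimizer
among the states which are accessible through `J`. -/
lemma exists_dist_le_of_staticCost_sub_le (hconv : ∀ i, StrictConvexOn ℝ univ (f i))
    (hdiff : ∀ i, Differentiable ℝ (f i)) (ha : ∀ i, a i ≠ 0)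
    (hW : IsUniformlyConnectedNetwork W) (hg : IsStronglySignPreserving g)
    (hX : IsInclusionSolution (fun t x => netFlow a (W t) '' essHull (linkResponse f a g) x) X)
    {C : Set (AllocState d n)} (hC : IsCompact C) (hXC : ∀ t, 0 ≤ t → X t ∈ C)
    (J : Finset (Fin n × Fin n)) :
    ∀ μ > 0, ∃ ε > 0, ∀ s t, 0 ≤ s → s ≤ t →
      staticCost f (X s) - staticCost f (X t) ≤ ε →
      (∀ e ∉ J, ∫ r in s..t, W r e.1 e.2 ≤ ε) → dist (X s) (X t) ≤ μ := by
  have hz := fun i => continuous_marginalCost (a := a) hconv hdiff i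
  have hG := isLinkResponse_linkResponse (f := f) (a := a) hg
  obtain ⟨M, hM0, hM⟩ := exists_forall_norm_linkResponse_le hg hz hC
  induction J using Finset.strongInduction with
  | H J ih =>
  intro μ hμ
  obtain ⟨ρ, hρ, hB⟩ := exists_dist_le_of_near_consensus hconv hdiff ha hC J hμ
  -- A displacement at most `μ'` changes marginal costs by at most `ρ / 4`.
  obtain ⟨μ', hμ', hμ'μ, hunif⟩ : ∃ μ' > 0, μ' ≤ μ ∧ ∀ x ∈ C, ∀ y ∈ C, dist x y ≤ μ' → ∀ i,
      dist (marginalCost f a x i) (marginalCost f a y i) ≤ ρ / 4 := by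
    have hu : UniformContinuousOn (fun x => marginalCost f a x) C :=
      hC.uniformContinuousOn_of_continuous (continuous_pi hz).continuousOn
    obtain ⟨δ, hδ, h⟩ := Metric.uniformContinuousOn_iff.1 hu (ρ / 4) (by positivity)
    refine ⟨min (δ / 2) μ, by positivity, min_le_right _ _, fun x hx y hy hxy i => ?_⟩
    exact (dist_le_pi_dist _ _ i).trans
      (h x hx y hy (by linarith [min_le_left (δ / 2) μ])).le
  obtain ⟨ε', hε', hih⟩ : ∃ ε' > 0, ∀ e ∈ J, ∀ s t, 0 ≤ s → s ≤ t →
      staticCost f (X s) - staticCost f (X t) ≤ ε' →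
      (∀ e' ∉ J.erase e, ∫ r in s..t, W r e'.1 e'.2 ≤ ε') → dist (X s) (X t) ≤ μ' := by
    choose! ε₀ hε₀ hih₀ using fun e (he : e ∈ J) => ih (J.erase e) (Finset.erase_ssubset he) μ' hμ'
    obtain ⟨ε', hε', hlt⟩ := J.exists_pos_forall_le ε₀ hε₀
    exact ⟨ε', hε', fun e he s t hs hst h1 h2 => hih₀ e he s t hs hst (h1.trans (hlt e he))
      fun e' he' => (h2 e' he').trans (hlt e he)⟩
  obtain ⟨κ, hκ, hdiss⟩ : ∃ κ > 0, ∀ e ∈ J, ∀ x ∈ C,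
      ρ / 4 ≤ ‖marginalCost f a x e.1 - marginalCost f a x e.2‖ →
      ∀ η ∈ essHull (linkResponse f a g) x,
        κ ≤ inner ℝ (marginalCost f a x e.1 - marginalCost f a x e.2) (η e.1 e.2) := by
    choose κ₀ hκ₀ hk using fun e : Fin n × Fin n =>
      exists_pos_forall_le_inner hg hz hC e.1 e.2 (by positivity : 0 < ρ / 4)
    obtain ⟨κ, hκ, hlt⟩ := J.exists_pos_forall_le κ₀ fun e _ => hκ₀ e
    exact ⟨κ, hκ, fun e he x hx h η hη => (hlt e he).trans (hk e x hx h η hη)⟩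
  obtain ⟨ε, hε, hεε', hεκ, hερ⟩ : ∃ ε > 0, ε ≤ ε' ∧ ε < κ / 2 * ε' ∧
      (Jᶜ.card * ε) * M ≤ ρ := by
    have h1 : ∀ᶠ ε in 𝓝[>] (0 : ℝ), ε ≤ ε' :=
      mem_nhdsWithin_of_mem_nhds (Iic_mem_nhds hε')
    have h2 : ∀ᶠ ε in 𝓝[>] (0 : ℝ), ε < κ / 2 * ε' :=
      mem_nhdsWithin_of_mem_nhds (Iio_mem_nhds (by positivity))
    have h3 : ∀ᶠ ε in 𝓝[>] (0 : ℝ), (Jᶜ.card * ε) * M ≤ ρ := by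
      have hc : Continuous fun ε : ℝ => (Jᶜ.card * ε) * M := by fun_prop
      exact mem_nhdsWithin_of_mem_nhds ((hc.tendsto 0).eventually_le_const (by simpa using hρ))
    obtain ⟨ε, ⟨⟨hε1, hε2⟩, hε3⟩, hε0⟩ := (((h1.and h2).and h3).and self_mem_nhdsWithin).exists
    exact ⟨ε, hε0, hε1, hε2, hε3⟩
  refine ⟨ε, hε, fun s t hs hst hcost hout => ?_⟩
  have hanti : ∀ r ∈ Icc s t, staticCost f (X s) - staticCost f (X r) ≤ ε := fun r hr =>
    le_trans (by linarith [staticCost_antitone hconv hdiff ha hW hG hX (hs.trans hr.1) hr.2]) hcost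
  by_cases hsmall : ∃ e ∈ J, ∫ r in s..t, W r e.1 e.2 ≤ ε'
  · obtain ⟨e, he, hwe⟩ := hsmall
    refine (hih e he s t hs hst (hcost.trans hεε') fun e' he' => ?_).trans hμ'μ
    by_cases hee : e' = e
    · rwa [hee]
    · exact (hout e' fun h => he' (Finset.mem_erase.2 ⟨hee, h⟩)).trans hεε'
  push Not at hsmall
  have hcons : ∀ e ∈ J, ‖marginalCost f a (X s) e.1 - marginalCost f a (X s) e.2‖ ≤ ρ := by
    rcases J.eq_empty_or_nonempty with hJ | hJ
    · simp [hJ]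
    -- The time `τ e` at which the weight accumulated by the link `e` reaches `ε'`.
    have hτ : ∀ e ∈ J, ∃ τ ∈ Icc s t, ∫ r in s..τ, W r e.1 e.2 = ε' := by
      intro e he
      have hcont : ContinuousOn (fun τ => ∫ r in s..τ, W r e.1 e.2) (Icc s t) := by
        have := intervalIntegral.continuousOn_primitive_interval'
          (hW.intervalIntegrable e.1 e.2 hs hst) left_mem_uIcc
        rwa [uIcc_of_le hst] at this
      have := intermediate_value_Icc hst hcont
      exact this ⟨by simpa using hε'.le, (hsmall e he).le⟩
    choose! τ hτm hτw using hτ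
    obtain ⟨e₀, he₀, hmax⟩ := J.exists_max_image τ hJ
    have hdisp : ∀ r ∈ Icc s (τ e₀), dist (X s) (X r) ≤ μ' := by
      intro r hr
      have hrt : r ≤ t := hr.2.trans (hτm e₀ he₀).2
      refine hih e₀ he₀ s r hs hr.1 ((hanti r ⟨hr.1, hrt⟩).trans hεε') fun e' he' => ?_
      by_cases hee : e' = e₀
      · rw [hee, ← hτw e₀ he₀]
        exact hW.integral_mono _ _ hs hr.1 hr.2
      · exact ((hW.integral_mono _ _ hs hr.1 hrt).trans
          (hout e' fun h => he' (Finset.mem_erase.2 ⟨hee, h⟩))).trans hεε'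
    intro e he
    obtain ⟨r, hr, hrρ⟩ : ∃ r ∈ Icc s (τ e),
        ‖marginalCost f a (X r) e.1 - marginalCost f a (X r) e.2‖ < ρ / 4 := by
      by_contra! hfar
      have h1 := staticCost_add_integral_le hconv hdiff ha hW hG hX hs (hτm e he).1 e.1 e.2
        (κ := κ) fun r hr η hη => hdiss e he _ (hXC r (hs.trans hr.1)) (hfar r hr) η hη
      rw [hτw e he] at h1
      linarith [hanti _ (hτm e he)]
    have hd := hdisp r ⟨hr.1, hr.2.trans (hmax e he)⟩
    have hu := hunif _ (hXC s hs) _ (hXC r (hs.trans hr.1)) hd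
    have h1 := hu e.1
    have h2 := hu e.2
    rw [dist_comm] at h2
    have h3 := dist_triangle4 (marginalCost f a (X s) e.1) (marginalCost f a (X r) e.1)
      (marginalCost f a (X r) e.2) (marginalCost f a (X s) e.2)
    rw [← dist_eq_norm] at hrρ ⊢
    linarith
  refine hB _ (hXC s hs) _ (hXC t (hs.trans hst))
    (staticCost_antitone hconv hdiff ha hW hG hX hs hst) hcons fun u hu => ?_
  refine (sum_inner_sub_le ha hW hG hX hs hst
    (fun r hr η hη => norm_le_of_mem_essHull (hM _ (hXC r (hs.trans hr.1))) hη) J hu).trans ?_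
  have h1 : ∑ e ∈ Jᶜ, ∫ r in s..t, W r e.1 e.2 ≤ Jᶜ.card * ε := by
    rw [← nsmul_eq_mul]
    exact Finset.sum_le_card_nsmul _ _ _ fun e he => hout e (Finset.mem_compl.1 he)
  calc _ ≤ (Jᶜ.card * ε) * (M * ‖u‖) := by gcongr
    _ = (Jᶜ.card * ε) * M * ‖u‖ := by ring
    _ ≤ ρ * ‖u‖ := by gcongr

end Trajectories

/-! ### Convergence to the optimal allocation -/

section Convergence

variable {d n : ℕ} {f : Fin n → EuclideanSpace ℝ (Fin d) → ℝ} {a : Fin n → ℝ}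
  {W : ℝ → Matrix (Fin n) (Fin n) ℝ} {g : EuclideanSpace ℝ (Fin d) → EuclideanSpace ℝ (Fin d)}
  {X : ℝ → AllocState d n}

/-- The intervals of uniform connectivity leave every bounded time interval, since each of them
carries at least a fixed weight, provided that there is a link at all. -/
lemma IsUniformlyConnectedNetwork.exists_le_start (hW : IsUniformlyConnectedNetwork W) {c : ℝ}
    (hc : 0 < c) {t l : ℕ → ℝ} (ht : ∀ k, 0 ≤ t k ∧ 0 ≤ l k ∧ t k + l k ≤ t (k + 1))
    (hlink : ∀ k, ∃ i j, c ≤ ∫ s in t k..(t k + l k), W s i j) (T : ℝ) : ∃ k, T ≤ t k := by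
  by_contra! hlt
  have hT : 0 ≤ T := (ht 0).1.trans (hlt 0).le
  have hge : ∀ k : ℕ, k * c ≤ ∑ e : Fin n × Fin n, ∫ s in (0 : ℝ)..t k, W s e.1 e.2 := by
    intro k
    induction k with
    | zero =>
      simpa using Finset.sum_nonneg fun (e : Fin n × Fin n) (_ : e ∈ Finset.univ) =>
        hW.integral_nonneg e.1 e.2 le_rfl (ht 0).1
    | succ k ih =>
      obtain ⟨i, j, hij⟩ := hlink k
      have hk := ht k
      have h1 : ∑ e : Fin n × Fin n, ((∫ s in (0 : ℝ)..t k, W s e.1 e.2) +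
          ∫ s in t k..(t k + l k), W s e.1 e.2) ≤
          ∑ e : Fin n × Fin n, ∫ s in (0 : ℝ)..t (k + 1), W s e.1 e.2 := by
        refine Finset.sum_le_sum fun e _ => ?_
        rw [intervalIntegral.integral_add_adjacent_intervals
          (hW.intervalIntegrable e.1 e.2 le_rfl hk.1)
          (hW.intervalIntegrable e.1 e.2 hk.1 (by linarith))]
        exact hW.integral_mono e.1 e.2 le_rfl (by linarith) hk.2.2
      rw [Finset.sum_add_distrib] at h1
      have h2 : ∫ s in t k..(t k + l k), W s i j ≤
          ∑ e : Fin n × Fin n, ∫ s in t k..(t k + l k), W s e.1 e.2 :=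
        Finset.single_le_sum (f := fun e : Fin n × Fin n => ∫ s in t k..(t k + l k), W s e.1 e.2)
          (fun e _ => hW.integral_nonneg e.1 e.2 hk.1 (by linarith)) (Finset.mem_univ (i, j))
      push_cast
      linarith
  obtain ⟨k, hk⟩ := exists_nat_gt ((∑ e : Fin n × Fin n, ∫ s in (0 : ℝ)..T, W s e.1 e.2) / c)
  have h1 := (div_lt_iff₀ hc).1 hk
  have h2 : ∑ e : Fin n × Fin n, ∫ s in (0 : ℝ)..t k, W s e.1 e.2 ≤
      ∑ e : Fin n × Fin n, ∫ s in (0 : ℝ)..T, W s e.1 e.2 := Finset.sum_le_sum fun e _ =>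
    hW.integral_mono e.1 e.2 le_rfl (ht k).1 (hlt k).le
  linarith [hge k]

lemma SimpleGraph.Connected.exists_adj_ne {V α : Type*} {Γ : SimpleGraph V} (hΓ : Γ.Connected)
    {z : V → α} {u v : V} (huv : z u ≠ z v) : ∃ x y, Γ.Adj x y ∧ z x ≠ z y := by
  by_contra! h
  obtain ⟨p⟩ := hΓ.preconnected u v
  refine huv ?_
  clear huv
  induction p with
  | nil => rfl
  | cons hadj _ ih => exact (h _ _ hadj).trans ih

/-- A solution which remains in a compact set converges, and the marginal costs of its limit are
in consensus. -/
lemma exists_tendsto_consensus (hconv : ∀ i, StrictConvexOn ℝ univ (f i))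
    (hdiff : ∀ i, Differentiable ℝ (f i)) (ha : ∀ i, a i ≠ 0)
    (hW : IsUniformlyConnectedNetwork W) (hg : IsStronglySignPreserving g)
    (hX : IsInclusionSolution (fun t x => netFlow a (W t) '' essHull (linkResponse f a g) x) X)
    {C : Set (AllocState d n)} (hC : IsCompact C) (hXC : ∀ t, 0 ≤ t → X t ∈ C) :
    ∃ Y, Tendsto X atTop (𝓝 Y) ∧ ∀ i j, marginalCost f a Y i = marginalCost f a Y j := by
  have hz := fun i => continuous_marginalCost (a := a) hconv hdiff i
  have hG := isLinkResponse_linkResponse (f := f) (a := a) hg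
  have hdrop : ∀ ε > 0, ∃ T, 0 ≤ T ∧ ∀ s t, T ≤ s → s ≤ t →
      staticCost f (X s) - staticCost f (X t) ≤ ε := by
    intro ε hε
    let S := (fun t => staticCost f (X t)) '' Ici (0 : ℝ)
    have hbdd : BddBelow S := by
      refine (hC.image (continuous_staticCost hdiff)).bddBelow.mono ?_
      rintro _ ⟨t, ht, rfl⟩
      exact mem_image_of_mem _ (hXC t ht)
    obtain ⟨_, ⟨T, hT, rfl⟩, hlt⟩ := exists_lt_of_csInf_lt (s := S)
      ⟨_, mem_image_of_mem _ self_mem_Ici⟩ (lt_add_of_pos_right (sInf S) hε)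
    refine ⟨T, hT, fun s t hs hst => ?_⟩
    have hT0 : (0 : ℝ) ≤ T := hT
    have h1 := staticCost_antitone hconv hdiff ha hW hG hX hT0 hs
    have h2 : sInf S ≤ staticCost f (X t) :=
      csInf_le hbdd (mem_image_of_mem _ (hT0.trans (hs.trans hst)))
    simp only at hlt
    linarith
  obtain ⟨Y, hY⟩ : ∃ Y, Tendsto X atTop (𝓝 Y) := by
    refine cauchySeq_tendsto_of_complete (Metric.cauchySeq_iff'.2 fun μ hμ => ?_)
    obtain ⟨ε, hε, h⟩ := exists_dist_le_of_staticCost_sub_le hconv hdiff ha hW hg hX hC hXC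
      Finset.univ (μ / 2) (half_pos hμ)
    obtain ⟨T, hT, hTd⟩ := hdrop ε hε
    refine ⟨T, fun t ht => ?_⟩
    rw [dist_comm]
    exact (h T t hT ht (hTd T t le_rfl ht) (by simp)).trans_lt (half_lt_self hμ)
  refine ⟨Y, hY, ?_⟩
  by_contra! hne
  obtain ⟨i₁, j₁, hij₁⟩ := hne
  obtain ⟨c, hc, t, l, ht, htree⟩ := hW.connected
  -- Each interval of connectivity contains an active link between different marginal costs at `Y`.
  have hlink : ∀ k, ∃ i j, marginalCost f a Y i ≠ marginalCost f a Y j ∧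
      c ≤ ∫ s in t k..(t k + l k), W s i j := by
    intro k
    obtain ⟨Γ, hΓ, hΓt⟩ := htree k
    obtain ⟨i, j, hadj, hij⟩ := hΓt.connected.exists_adj_ne (z := marginalCost f a Y) hij₁
    have h := hΓ hadj
    rw [unionGraph, SimpleGraph.fromRel_adj] at h
    rcases h.2 with h | h
    · exact ⟨i, j, hij, h⟩
    · exact ⟨j, i, hij.symm, h⟩
  classical
  let P : Finset (Fin n × Fin n) :=
    Finset.univ.filter fun e => marginalCost f a Y e.1 ≠ marginalCost f a Y e.2
  have hloc : ∀ e ∈ P, ∃ κ > 0, ∀ᶠ Z in 𝓝 Y, ∀ η ∈ essHull (linkResponse f a g) Z,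
      κ ≤ inner ℝ (marginalCost f a Z e.1 - marginalCost f a Z e.2) (η e.1 e.2) := fun e he =>
    exists_pos_le_inner hg hz (Finset.mem_filter.1 he).2
  choose! κ₀ hκ₀ hev using hloc
  obtain ⟨κ, hκ, hle⟩ := P.exists_pos_forall_le κ₀ hκ₀
  obtain ⟨T₁, hT₁⟩ := eventually_atTop.1 (hY.eventually ((Finset.eventually_all P).2 hev))
  obtain ⟨T₂, hT₂, hT₂d⟩ := hdrop (κ / 2 * c / 2) (by positivity)
  obtain ⟨k, hk⟩ := hW.exists_le_start hc ht
    (fun k => (hlink k).imp fun i ⟨j, h⟩ => ⟨j, h.2⟩) (max T₁ T₂)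
  obtain ⟨i, j, hij, hcij⟩ := hlink k
  have hmem : (i, j) ∈ P := Finset.mem_filter.2 ⟨Finset.mem_univ _, hij⟩
  have hkl : t k ≤ t k + l k := by linarith [(ht k).2.1]
  have h1 := staticCost_add_integral_le hconv hdiff ha hW hG hX (ht k).1 hkl i j (κ := κ)
    fun r hr η hη => (hle (i, j) hmem).trans
      (hT₁ r ((le_max_left _ _).trans (hk.trans hr.1)) (i, j) hmem η hη)
  have h2 := hT₂d (t k) (t k + l k) ((le_max_right _ _).trans hk) hkl
  have h3 := mul_le_mul_of_nonneg_left hcij (half_pos hκ).le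
  have h4 : 0 < κ / 2 * c := by positivity
  linarith

/-- A feasible state with equal marginal costs is the strict minimizer of the cost. -/
lemma staticCost_lt_of_consensus (hconv : ∀ i, StrictConvexOn ℝ univ (f i))
    (hdiff : ∀ i, Differentiable ℝ (f i)) (ha : ∀ i, a i ≠ 0) {b : EuclideanSpace ℝ (Fin d)}
    {Y Z : AllocState d n} (hY : Y ∈ feasibleSet a b) (hZ : Z ∈ feasibleSet a b)
    (hcons : ∀ i j, marginalCost f a Y i = marginalCost f a Y j) (hne : Y ≠ Z) :
    staticCost f Y < staticCost f Z := by
  obtain ⟨i₀, -⟩ := Function.ne_iff.1 hne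
  have hzero : ∑ i, a i * inner ℝ (marginalCost f a Y i) (Z i - Y i) = 0 := by
    have hYb : ∑ i, a i • Y i = b := hY
    have hZb : ∑ i, a i • Z i = b := hZ
    calc ∑ i, a i * inner ℝ (marginalCost f a Y i) (Z i - Y i)
        = inner ℝ (marginalCost f a Y i₀) (∑ i, a i • Z i - ∑ i, a i • Y i) := by
          rw [← Finset.sum_sub_distrib, inner_sum]
          refine Finset.sum_congr rfl fun i _ => ?_
          rw [← smul_sub, inner_smul_right, hcons i i₀]
      _ = 0 := by rw [hYb, hZb, sub_self, inner_zero_right]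
  have h := staticCost_add_sum_inner_lt hconv hdiff ha hne
  rwa [hzero, add_zero] at h

lemma isClosed_feasibleSet (a : Fin n → ℝ) (b : EuclideanSpace ℝ (Fin d)) :
    IsClosed (feasibleSet a b) :=
  isClosed_eq (by fun_prop) continuous_const

lemma isCompact_sublevel (hdiff : ∀ i, Differentiable ℝ (f i)) {b : EuclideanSpace ℝ (Fin d)}
    (hlevel : ∀ γ : ℝ, Bornology.IsBounded {X | X ∈ feasibleSet a b ∧ staticCost f X ≤ γ})
    (γ : ℝ) : IsCompact {X | X ∈ feasibleSet a b ∧ staticCost f X ≤ γ} :=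
  Metric.isCompact_of_isClosed_isBounded ((isClosed_feasibleSet a b).inter
    (isClosed_le (continuous_staticCost hdiff) continuous_const)) (hlevel γ)

lemma netFlow_eq_sum (a : Fin n → ℝ) (w : Matrix (Fin n) (Fin n) ℝ) : netFlow (d := d) a w =
    ∑ i, ∑ j, w i j • netFlow a (Matrix.single i j 1) := by
  ext η i : 2
  simp only [netFlow_apply, Matrix.single_apply, sum_apply,
    smul_apply, Finset.sum_apply, Pi.smul_apply, ite_and, ite_smul, one_smul,
    zero_smul, Finset.smul_sum]
  simp [smul_smul, mul_comm]

lemma IsUniformlyConnectedNetwork.integrableOn_indicator (hW : IsUniformlyConnectedNetwork W)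
    (i j : Fin n) {S : Set ℝ} (hS : IsCompact S) :
    IntegrableOn ((Ici (0 : ℝ)).indicator fun r => W r i j) S := by
  obtain ⟨T, hT⟩ := hS.bddAbove
  have h0 : IntegrableOn (fun r => W r i j) (Ici 0) (volume.restrict S) := by
    rw [IntegrableOn, Measure.restrict_restrict measurableSet_Ici]
    exact (hW.integrable i j T).mono_set fun t ht => ⟨ht.1, hT ht.2⟩
  exact h0.integrable_indicator measurableSet_Ici

lemma locallyIntegrable_sum_smul {V : Type*} [NormedAddCommGroup V] [NormedSpace ℝ V]
    {w : Fin n → Fin n → ℝ → ℝ} (hw : ∀ i j, ∀ S : Set ℝ, IsCompact S → IntegrableOn (w i j) S)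
    (B : Fin n → Fin n → V) : LocallyIntegrable fun t => ∑ i, ∑ j, w i j t • B i j :=
  locallyIntegrable_iff.2 fun S hS => integrable_finsetSum _ fun i _ =>
    integrable_finsetSum _ fun j _ => (hw i j S hS).smul_const _

/-- The weights, which matter at nonnegative times only, are extended by zero. -/
lemma locallyIntegrable_netFlow (hW : IsUniformlyConnectedNetwork W) :
    LocallyIntegrable fun t => netFlow (d := d) a
      fun i j => (Ici (0 : ℝ)).indicator (fun r => W r i j) t := by
  have h := locallyIntegrable_sum_smul (fun i j _ hS => hW.integrableOn_indicator i j hS)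
    fun i j => netFlow (d := d) a (Matrix.single i j 1)
  rwa [← funext fun t => netFlow_eq_sum (d := d) a
    fun i j => (Ici (0 : ℝ)).indicator (fun r => W r i j) t] at h

/-- Existence of solutions. Outside a large ball the link responses are replaced by zero, to make
them bounded. This does not matter, since solutions remain in a sublevel set of the cost. -/
lemma exists_solution_of_mem_feasibleSet (hconv : ∀ i, StrictConvexOn ℝ univ (f i))
    (hdiff : ∀ i, Differentiable ℝ (f i)) (ha : ∀ i, a i ≠ 0) {b : EuclideanSpace ℝ (Fin d)}
    (hlevel : ∀ γ : ℝ, Bornology.IsBounded {X | X ∈ feasibleSet a b ∧ staticCost f X ≤ γ})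
    (hW : IsUniformlyConnectedNetwork W) (hg : IsStronglySignPreserving g)
    {X₀ : AllocState d n} (hX₀ : X₀ ∈ feasibleSet a b) :
    ∃ X, IsInclusionSolution (fun t x => netFlow a (W t) '' essHull (linkResponse f a g) x) X ∧
      X 0 = X₀ := by
  have hz := fun i => continuous_marginalCost (a := a) hconv hdiff i
  obtain ⟨R, hR⟩ := (hlevel (staticCost f X₀)).subset_ball (0 : AllocState d n)
  let B : Set (AllocState d n) := Metric.ball 0 R
  let G := B.indicator (linkResponse f a g)
  have hG : IsLinkResponse f a G := (isLinkResponse_linkResponse hg).indicator B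
  obtain ⟨M, hM0, hM⟩ := exists_forall_norm_linkResponse_le hg hz
    (isCompact_closedBall (0 : AllocState d n) R)
  have hGM : ∀ x, ‖G x‖ ≤ M := by
    intro x
    by_cases hx : x ∈ B
    · simpa [G, hx] using (hM x (Metric.ball_subset_closedBall hx)).self_of_nhds
    · simpa [G, hx] using hM0
  have hGM' : ∀ x, ∀ᶠ y in 𝓝 x, ‖G y‖ ≤ M := fun x => Eventually.of_forall hGM
  obtain ⟨X, hX, hX0⟩ := exists_isInclusionSolution (locallyIntegrable_netFlow (a := a) hW)
    (K := essHull G) (fun x η hη => norm_le_of_mem_essHull (hGM' x) hη)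
    (fun x => essHull_nonempty (hGM' x)) (convex_essHull G) (isClosed_essHull G)
    (fun x U hU h => eventually_essHull_subset (hGM' x) hU h) X₀
  have hXG : IsInclusionSolution (fun t x => netFlow a (W t) '' essHull G x) X := by
    refine ⟨hX.1, ?_⟩
    filter_upwards [hX.2] with t h ht
    simpa [ht] using h ht
  refine ⟨X, ⟨hX.1, ?_⟩, hX0⟩
  filter_upwards [hXG.2] with t h ht
  obtain ⟨_, ⟨η, hη, rfl⟩, hv⟩ := h ht
  have hmem : X t ∈ B := hR ⟨mem_feasibleSet_of_isInclusionSolution ha hW hG hXG (hX0 ▸ hX₀) ht,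
    hX0 ▸ staticCost_antitone hconv hdiff ha hW hG hXG le_rfl ht⟩
  have heq : G =ᶠ[𝓝 (X t)] linkResponse f a g := by
    filter_upwards [Metric.isOpen_ball.mem_nhds hmem] with y hy
    exact indicator_of_mem hy _
  exact ⟨_, mem_image_of_mem _ (essHull_subset_of_eventuallyEq heq hη), hv⟩

/-- A strict minimizer of the cost is Lyapunov stable, since the cost decreases along solutions and
its sublevel sets are compact. -/
lemma exists_stability_radius (hdiff : ∀ i, Differentiable ℝ (f i)) {b : EuclideanSpace ℝ (Fin d)}
    (hlevel : ∀ γ : ℝ, Bornology.IsBounded {X | X ∈ feasibleSet a b ∧ staticCost f X ≤ γ})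
    {Y : AllocState d n}
    (hmin : ∀ Z ∈ feasibleSet a b, Y ≠ Z → staticCost f Y < staticCost f Z) {ε : ℝ} (hε : 0 < ε) :
    ∃ δ > 0, ∀ Z₀ Z, dist Z₀ Y < δ → Z ∈ feasibleSet a b → staticCost f Z ≤ staticCost f Z₀ →
      dist Z Y < ε := by
  have hcpt : IsCompact ({Z | Z ∈ feasibleSet a b ∧ staticCost f Z ≤ staticCost f Y + 1} ∩
      {Z | ε ≤ dist Z Y}) := (isCompact_sublevel hdiff hlevel _).inter_right
    (isClosed_le continuous_const (by fun_prop))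
  obtain ⟨m, hm, hmle⟩ : ∃ m > staticCost f Y, ∀ Z ∈ ({Z | Z ∈ feasibleSet a b ∧
      staticCost f Z ≤ staticCost f Y + 1} ∩ {Z | ε ≤ dist Z Y}), m ≤ staticCost f Z := by
    rcases Set.eq_empty_or_nonempty ({Z | Z ∈ feasibleSet a b ∧
      staticCost f Z ≤ staticCost f Y + 1} ∩ {Z | ε ≤ dist Z Y}) with h | h
    · exact ⟨staticCost f Y + 1, by simp, by simp [h]⟩
    · obtain ⟨Z, hZ, hZm⟩ := hcpt.exists_isMinOn h (continuous_staticCost hdiff).continuousOn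
      refine ⟨staticCost f Z, hmin Z hZ.1.1 fun h => ?_, fun Z' hZ' => hZm hZ'⟩
      have h2 : ε ≤ dist Z Y := hZ.2
      rw [h, dist_self] at h2
      linarith
  obtain ⟨δ, hδ, hball⟩ := Metric.eventually_nhds_iff_ball.1
    (((continuous_staticCost hdiff).tendsto Y).eventually_lt_const
      (lt_min hm (lt_add_one (staticCost f Y))))
  refine ⟨δ, hδ, fun Z₀ Z h₀ hZ hle => ?_⟩
  by_contra! hfar
  have h1 := hle.trans_lt (hball Z₀ h₀)
  have h2 := hmle Z ⟨⟨hZ, (h1.trans_le (min_le_right _ _)).le⟩, hfar⟩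
  linarith [h1.trans_le (min_le_left _ _)]

end Convergence

theorem mainTheorem1 (d n : ℕ)
    (f : Fin n → EuclideanSpace ℝ (Fin d) → ℝ) (fhat : Fin n → ℝ → ℝ)
    (hconv : ∀ i, StrictConvexOn ℝ univ (f i)) (hdiff : ∀ i, Differentiable ℝ (f i))
    (a : Fin n → ℝ) (ha : ∀ i, a i ≠ 0) (b : EuclideanSpace ℝ (Fin d))
    (hlevel : ∀ γ : ℝ, Bornology.IsBounded {X | X ∈ feasibleSet a b ∧ staticCost f X ≤ γ})
    (W : ℝ → Matrix (Fin n) (Fin n) ℝ) (hW : IsUniformlyConnectedNetwork W)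
    (g : EuclideanSpace ℝ (Fin d) → EuclideanSpace ℝ (Fin d))
    (hg : IsStronglySignPreserving g) :
    ∃ Xstar : AllocState d n,
      (∀ t : ℝ, 0 ≤ t → ∀ Y, IsOptimalAllocation f fhat a b t Y ↔ Y = Xstar) ∧
      (∀ X₀ ∈ feasibleSet a b, ∃ X : ℝ → AllocState d n,
        IsInclusionSolution (laplacianGradientInclusion f a W g) X ∧ X 0 = X₀) ∧
      (∀ X : ℝ → AllocState d n, IsInclusionSolution (laplacianGradientInclusion f a W g) X →
        X 0 ∈ feasibleSet a b →
        (∀ t : ℝ, 0 ≤ t → X t ∈ feasibleSet a b) ∧ Tendsto X atTop (𝓝 Xstar)) ∧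
      IsGloballyStronglyAsymptoticallyStableOn (laplacianGradientInclusion f a W g)
        (feasibleSet a b) Xstar := by
  have hz := fun i => continuous_marginalCost (a := a) hconv hdiff i
  have hG := isLinkResponse_linkResponse (f := f) (a := a) hg
  have heq : laplacianGradientInclusion f a W g =
      fun t x => netFlow a (W t) '' essHull (linkResponse f a g) x :=
    funext fun t => funext fun x => laplacianGradientInclusion_eq hg hz t x
  rw [heq]
  have hfeas : ∀ X : ℝ → AllocState d n,
      IsInclusionSolution (fun t x => netFlow a (W t) '' essHull (linkResponse f a g) x) X →
      X 0 ∈ feasibleSet a b → ∀ t : ℝ, 0 ≤ t → X t ∈ feasibleSet a b := fun X hX h0 t ht =>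
    mem_feasibleSet_of_isInclusionSolution ha hW hG hX h0 ht
  have hlim : ∀ X : ℝ → AllocState d n,
      IsInclusionSolution (fun t x => netFlow a (W t) '' essHull (linkResponse f a g) x) X →
      X 0 ∈ feasibleSet a b → ∃ Y ∈ feasibleSet a b, Tendsto X atTop (𝓝 Y) ∧
        ∀ Z ∈ feasibleSet a b, Y ≠ Z → staticCost f Y < staticCost f Z := by
    intro X hX h0
    obtain ⟨Y, hY, hcons⟩ := exists_tendsto_consensus hconv hdiff ha hW hg hX
      (isCompact_sublevel hdiff hlevel (staticCost f (X 0))) fun t ht =>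
        ⟨hfeas X hX h0 t ht, staticCost_antitone hconv hdiff ha hW hG hX le_rfl ht⟩
    have hYb : Y ∈ feasibleSet a b := (isClosed_feasibleSet a b).mem_of_tendsto hY
      ((eventually_ge_atTop 0).mono fun t ht => hfeas X hX h0 t ht)
    exact ⟨Y, hYb, hY, fun Z hZ hne => staticCost_lt_of_consensus hconv hdiff ha hYb hZ hcons hne⟩
  -- The network has at least one agent, so that the feasible set is not empty.
  obtain ⟨X₀, hX₀⟩ : (feasibleSet a b).Nonempty := by
    obtain ⟨c, -, t, l, -, htree⟩ := hW.connected
    obtain ⟨Γ, -, hΓ⟩ := htree 0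
    obtain ⟨i⟩ := hΓ.connected.nonempty
    refine ⟨Pi.single i ((a i)⁻¹ • b), ?_⟩
    have : ∑ j, a j • (Pi.single i ((a i)⁻¹ • b) : AllocState d n) j = b := by
      rw [Finset.sum_eq_single i (fun j _ hj => by simp [hj]) (by simp)]
      simp [ha i]
    exact this
  obtain ⟨X, hX, hX0⟩ := exists_solution_of_mem_feasibleSet hconv hdiff ha hlevel hW hg hX₀
  obtain ⟨Xstar, hfeasstar, -, hmin⟩ := hlim X hX (hX0 ▸ hX₀)
  have htend : ∀ X : ℝ → AllocState d n,
      IsInclusionSolution (fun t x => netFlow a (W t) '' essHull (linkResponse f a g) x) X →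
      X 0 ∈ feasibleSet a b → Tendsto X atTop (𝓝 Xstar) := by
    intro X hX h0
    obtain ⟨Y, hY, hXY, hYmin⟩ := hlim X hX h0
    suffices Y = Xstar by rwa [← this]
    by_contra hne
    exact lt_asymm (hYmin Xstar hfeasstar hne) (hmin Y hY (Ne.symm hne))
  refine ⟨Xstar, fun t _ Y => ?_, fun X₀ hX₀ =>
    exists_solution_of_mem_feasibleSet hconv hdiff ha hlevel hW hg hX₀,
    fun X hX h0 => ⟨hfeas X hX h0, htend X hX h0⟩, hfeasstar, fun ε hε => ?_, htend⟩
  · have hcost : ∀ Z, totalCost f fhat Z t = staticCost f Z + ∑ i, fhat i t := fun Z =>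
      Finset.sum_add_distrib
    constructor
    · rintro ⟨hY, hYmin⟩
      by_contra hne
      have h1 : totalCost f fhat Y t ≤ totalCost f fhat Xstar t := hYmin hfeasstar
      rw [hcost, hcost] at h1
      linarith [hmin Y hY (Ne.symm hne)]
    · rintro rfl
      refine ⟨hfeasstar, fun Z hZ => ?_⟩
      show totalCost f fhat Y t ≤ totalCost f fhat Z t
      rw [hcost, hcost]
      rcases eq_or_ne Y Z with rfl | hne
      · exact le_rfl
      · linarith [hmin Z hZ hne]
  · obtain ⟨δ, hδ, h⟩ := exists_stability_radius hdiff hlevel hmin hε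
    exact ⟨δ, hδ, fun X hX h0 hd t ht => h (X 0) (X t) hd (hfeas X hX h0 t ht)
      (staticCost_antitone hconv hdiff ha hW hG hX le_rfl ht)⟩
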